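/- Let $\Bbbk$ be a commutative ring. For $n\ge 0$ let $\mathrm{ONH}_n$ be the odd nilHecke algebra: the unital $\Bbbk$-algebra generated by $x_1,\dots,x_n$ (dots) and $\partial_1,\dots,\partial_{n-1}$ (crossings) with relations $$x_ix_j+x_jx_i=0\ (i\ne j),\quad \partial_i^2=0,\quad \partial_i\partial_j+\partial_j\partial_i=0\ (|i-j|>1),\quad \partial_i\partial_{i+1}\partial_i=\partial_{i+1}\partial_i\partial_{i+1},$$ $$\partial_ix_j+x_j\partial_i=0\ (j\ne i,i+1),\qquad x_i\partial_i+\partial_ix_{i+1}=1=\partial_ix_i+x_{i+1}\partial_i .$$ It is a superalgebra with all generators odd, and a dg algebra with the differential $d$ determined by $d(x_i)=x_i^2$, $d(\partial_i)=1$ and $d(uv)=d(u)v+(-1)^{p(u)}u\,d(v)$. For $u\in\mathrm{ONH}_a$ and $v\in\mathrm{ONH}_b$ let $u\boxtimes v\in\mathrm{ONH}_{a+b}$ be the product $u\cdot v'$, where $u$ is placed on strands $1,\dots,a$ and $v'$ is $v$ placed on strands $a+1,\dots,a+b$. Put $$\mathtt e_n=(-1)^{\binom n3}\,\partial_1(\partial_2\partial_1)\cdots(\partial_{n-1}\cdots\partial_1)\;x_1^{n-1}x_2^{n-2}\cdots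 x_{n-1},\qquad \widetilde e_1=\sum_{i=1}^n(-1)^{i-1}x_i\in\mathrm{ONH}_n ,$$ and $\{m\}=0$ for even $m$, $\{m\}=1$ for odd $m$. In odd thick calculus, a strand of thickness $n$ is the idempotent $\mathtt e_n$, and a strand of thickness $n$ with label $f$ is $\mathtt e_nf\mathtt e_n$. Products $uv$ are drawn with $u$ above $v$. A thick diagram whose top and bottom boundaries are idempotents $\mathtt e$ and $\mathtt f$ is an element $s\in\mathtt e\,\mathrm{ONH}_n\,\mathtt f$. It stands for the left module homomorphism $\mathrm{ONH}_n\mathtt e\to\mathrm{ONH}_n\mathtt f$, $m\mapsto(-1)^{p(s)p(m)}ms$, and the differential induced on such diagrams is $d_{\mathrm{th}}(s)=\mathtt e\,d(s)$. For $a,b\ge1$, write $\mathtt e_{a,b}=\mathtt e_a\boxtimes\mathtt e_b$ and $$\partial_{a,b}=(\partial_b\cdots\partial_1)(\partial_{b+1}\cdots\partial_2)\cdots(\partial_{a+b-1}\cdots\partial_a),$$ and define the splitter (bottom $a+b$, top $a,b$) and the merge (bottom $a,b$, top $a+b$) by $$S_{a,b}=\mathtt e_{a,b}\,\mathtt e_{a+b},\qquad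 M_{a,b}=\mathtt e_{a+b}\,\partial_{a,b}\,\mathtt e_{a,b}.$$ **Proposition.** For all integers $a,b\ge1$, the following identities hold in $\mathrm{ONH}_{a+b}$: $$d_{\mathrm{th}}(S_{a,b})=\mathtt e_{a,b}\,d(S_{a,b})=\{a\}\,\bigl(\mathtt e_a\boxtimes\mathtt e_b\widetilde e_1\mathtt e_b\bigr)\,S_{a,b},$$ $$d_{\mathrm{th}}(M_{a,b})=\mathtt e_{a+b}\,d(M_{a,b})=(-1)^{ab-1}\{b\}\;M_{a,b}\,\bigl(\mathtt e_a\widetilde e_1\mathtt e_a\boxtimes\mathtt e_b\bigr).$$ That is, the differential of the splitter is $\{a\}$ times the splitter with $\widetilde e_1$ on the $b$-leg, and the differential of the merge is $(-1)^{ab-1}\{b\}$ times the merge with $\widetilde e_1$ on the $a$-leg. -/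

import Mathlib

/-! Odd nilHecke algebras by generators and relations, their diagrammatically local
differential, and the splitter and merge diagrams of odd thick calculus. Strands are
numbered `1, …, n` from left to right, and a product `u * v` is the diagram `u` stacked on
top of the diagram `v`. -/

noncomputable section

namespace OddThick

/-- Dots and crossings on `n` strands. -/
inductive Gen (n : ℕ) : Type
  /-- A dot on strand `i`. -/
  | dot (i : ℕ) (h : 1 ≤ i ∧ i ≤ n) : Gen n
  /-- A crossing of strands `i` and `i + 1`. -/
  | cross (i : ℕ) (h : 1 ≤ i ∧ i < n) : Gen n

/-- A dot on strand `i`, in the free algebra on the generators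
(used for `1 ≤ i ≤ n` only, and `0` otherwise). -/
def freeX (k : Type*) [CommRing k] (n i : ℕ) : FreeAlgebra k (Gen n) :=
  if h : 1 ≤ i ∧ i ≤ n then FreeAlgebra.ι k (Gen.dot i h) else 0

/-- A crossing of strands `i`, `i + 1`, in the free algebra on the generators
(used for `1 ≤ i < n` only, and `0` otherwise). -/
def freeD (k : Type*) [CommRing k] (n i : ℕ) : FreeAlgebra k (Gen n) :=
  if h : 1 ≤ i ∧ i < n then FreeAlgebra.ι k (Gen.cross i h) else 0

/-- The defining relations of the odd nilHecke algebra on `n` strands. All indices of dots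
range over `1, …, n` and all indices of crossings over `1, …, n - 1`; out of that range a
relation either is left out or reads `0 = 0`. -/
inductive Rel (k : Type*) [CommRing k] (n : ℕ) :
    FreeAlgebra k (Gen n) → FreeAlgebra k (Gen n) → Prop
  | dot_dot (i j : ℕ) (h : i ≠ j) :
      Rel k n (freeX k n i * freeX k n j + freeX k n j * freeX k n i) 0
  | cross_cross (i j : ℕ) (h : i + 1 < j ∨ j + 1 < i) :
      Rel k n (freeD k n i * freeD k n j + freeD k n j * freeD k n i) 0
  | cross_sq (i : ℕ) : Rel k n (freeD k n i * freeD k n i) 0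
  | braid (i : ℕ) :
      Rel k n (freeD k n i * freeD k n (i + 1) * freeD k n i)
        (freeD k n (i + 1) * freeD k n i * freeD k n (i + 1))
  | cross_dot (i j : ℕ) (h : j ≠ i) (h' : j ≠ i + 1) :
      Rel k n (freeD k n i * freeX k n j + freeX k n j * freeD k n i) 0
  | slide_left (i : ℕ) (h : 1 ≤ i ∧ i < n) :
      Rel k n (freeX k n i * freeD k n i + freeD k n i * freeX k n (i + 1)) 1
  | slide_right (i : ℕ) (h : 1 ≤ i ∧ i < n) :
      Rel k n (freeD k n i * freeX k n i + freeX k n (i + 1) * freeD k n i) 1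

/-- The odd nilHecke algebra on `n` strands over `k`. -/
def ONH (k : Type*) [CommRing k] (n : ℕ) : Type _ := RingQuot (Rel k n)

instance (k : Type*) [CommRing k] (n : ℕ) : Ring (ONH k n) :=
  inferInstanceAs (Ring (RingQuot (Rel k n)))

instance (k : Type*) [CommRing k] (n : ℕ) : Algebra k (ONH k n) :=
  inferInstanceAs (Algebra k (RingQuot (Rel k n)))

section

variable (k : Type*) [CommRing k] (n : ℕ)

/-- The projection from the free algebra. -/
def mk : FreeAlgebra k (Gen n) →ₐ[k] ONH k n := RingQuot.mkAlgHom k (Rel k n)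

/-- A dot on strand `i`, for `1 ≤ i ≤ n`. -/
def X (i : ℕ) : ONH k n := mk k n (freeX k n i)

/-- A crossing of strands `i` and `i + 1`, for `1 ≤ i < n`. -/
def D (i : ℕ) : ONH k n := mk k n (freeD k n i)

variable {k n}

theorem mk_rel {u v : FreeAlgebra k (Gen n)} (h : Rel k n u v) : mk k n u = mk k n v :=
  RingQuot.mkAlgHom_rel k h

theorem mk_surjective : Function.Surjective (mk k n) :=
  RingQuot.mkAlgHom_surjective k (Rel k n)

theorem X_of_not {i : ℕ} (h : ¬ (1 ≤ i ∧ i ≤ n)) : X k n i = 0 := by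
  simp [X, freeX, h]

theorem D_of_not {i : ℕ} (h : ¬ (1 ≤ i ∧ i < n)) : D k n i = 0 := by
  simp [D, freeD, h]

theorem X_mul_X {i j : ℕ} (h : i ≠ j) : X k n i * X k n j + X k n j * X k n i = 0 := by
  simpa [X] using mk_rel (Rel.dot_dot (k := k) (n := n) i j h)

theorem D_mul_D {i j : ℕ} (h : i + 1 < j ∨ j + 1 < i) :
    D k n i * D k n j + D k n j * D k n i = 0 := by
  simpa [D] using mk_rel (Rel.cross_cross (k := k) (n := n) i j h)

theorem D_sq (i : ℕ) : D k n i * D k n i = 0 := by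
  simpa [D] using mk_rel (Rel.cross_sq (k := k) (n := n) i)

theorem D_braid (i : ℕ) :
    D k n i * D k n (i + 1) * D k n i = D k n (i + 1) * D k n i * D k n (i + 1) := by
  simpa [D] using mk_rel (Rel.braid (k := k) (n := n) i)

theorem D_mul_X {i j : ℕ} (h : j ≠ i) (h' : j ≠ i + 1) :
    D k n i * X k n j + X k n j * D k n i = 0 := by
  simpa [D, X] using mk_rel (Rel.cross_dot (k := k) (n := n) i j h h')

theorem slide_left {i : ℕ} (h : 1 ≤ i ∧ i < n) :
    X k n i * D k n i + D k n i * X k n (i + 1) = 1 := by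
  simpa [D, X] using mk_rel (Rel.slide_left (k := k) (n := n) i h)

theorem slide_right {i : ℕ} (h : 1 ≤ i ∧ i < n) :
    D k n i * X k n i + X k n (i + 1) * D k n i = 1 := by
  simpa [D, X] using mk_rel (Rel.slide_right (k := k) (n := n) i h)

/-- The universal property: an algebra homomorphism out of the odd nilHecke algebra is given
by images of the dots and crossings that satisfy the defining relations. -/
def lift {A : Type*} [Ring A] [Algebra k A] (x y : ℕ → A)
    (dot_dot : ∀ i j, 1 ≤ i ∧ i ≤ n → 1 ≤ j ∧ j ≤ n → i ≠ j → x i * x j + x j * x i = 0)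
    (cross_cross : ∀ i j, 1 ≤ i ∧ i < n → 1 ≤ j ∧ j < n → i + 1 < j ∨ j + 1 < i →
      y i * y j + y j * y i = 0)
    (cross_sq : ∀ i, 1 ≤ i ∧ i < n → y i * y i = 0)
    (braid : ∀ i, 1 ≤ i ∧ i + 1 < n → y i * y (i + 1) * y i = y (i + 1) * y i * y (i + 1))
    (cross_dot : ∀ i j, 1 ≤ i ∧ i < n → 1 ≤ j ∧ j ≤ n → j ≠ i → j ≠ i + 1 →
      y i * x j + x j * y i = 0)
    (left : ∀ i, 1 ≤ i ∧ i < n → x i * y i + y i * x (i + 1) = 1)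
    (right : ∀ i, 1 ≤ i ∧ i < n → y i * x i + x (i + 1) * y i = 1) :
    ONH k n →ₐ[k] A :=
  RingQuot.liftAlgHom k (s := Rel k n)
    ⟨FreeAlgebra.lift k (fun g : Gen n => match g with
      | .dot i _ => x i
      | .cross i _ => y i), by
      set φ := FreeAlgebra.lift k (fun g : Gen n => match g with
        | .dot i _ => x i
        | .cross i _ => y i) with hφ
      have hX : ∀ i, φ (freeX k n i) = if 1 ≤ i ∧ i ≤ n then x i else 0 := by
        intro i; unfold freeX; split_ifs <;> simp [hφ]
      have hD : ∀ i, φ (freeD k n i) = if 1 ≤ i ∧ i < n then y i else 0 := by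
        intro i; unfold freeD; split_ifs <;> simp [hφ]
      intro u v h
      induction h with
      | dot_dot i j h =>
        simp only [map_add, map_mul, hX, map_zero]
        split_ifs with h1 h2 <;> simp_all
      | cross_cross i j h =>
        simp only [map_add, map_mul, hD, map_zero]
        split_ifs with h1 h2
        · exact cross_cross i j h1 h2 h
        all_goals simp
      | cross_sq i =>
        simp only [map_mul, hD, map_zero]
        split_ifs with h1
        · exact cross_sq i h1
        · simp
      | braid i =>
        simp only [map_mul, hD]
        split_ifs with h1 h2
        · exact braid i ⟨h1.1, h2.2⟩
        all_goals simp
      | cross_dot i j h h' =>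
        simp only [map_add, map_mul, hX, hD, map_zero]
        split_ifs with h1 h2
        · exact cross_dot i j h1 h2 h h'
        all_goals simp
      | slide_left i h =>
        have h1 : 1 ≤ i ∧ i ≤ n := by omega
        have h2 : 1 ≤ i + 1 ∧ i + 1 ≤ n := by omega
        simp only [map_add, map_mul, hX, hD, map_one, if_pos h, if_pos h1, if_pos h2]
        exact left i h
      | slide_right i h =>
        have h1 : 1 ≤ i ∧ i ≤ n := by omega
        have h2 : 1 ≤ i + 1 ∧ i + 1 ≤ n := by omega
        simp only [map_add, map_mul, hX, hD, map_one, if_pos h, if_pos h1, if_pos h2]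
        exact right i h⟩

section

variable {A : Type*} [Ring A] [Algebra k A] (x y : ℕ → A) (h1 h2 h3 h4 h5 h6 h7)

theorem lift_X {i : ℕ} (h : 1 ≤ i ∧ i ≤ n) :
    lift (k := k) (n := n) x y h1 h2 h3 h4 h5 h6 h7 (X k n i) = x i := by
  unfold lift X mk freeX
  rw [dif_pos h]
  erw [RingQuot.liftAlgHom_mkAlgHom_apply]
  simp

theorem lift_D {i : ℕ} (h : 1 ≤ i ∧ i < n) :
    lift (k := k) (n := n) x y h1 h2 h3 h4 h5 h6 h7 (D k n i) = y i := by
  unfold lift D mk freeD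
  rw [dif_pos h]
  erw [RingQuot.liftAlgHom_mkAlgHom_apply]
  simp

end

/-- Induction on elements of the odd nilHecke algebra. -/
theorem induction {P : ONH k n → Prop} (scalar : ∀ c : k, P (algebraMap k _ c))
    (dot : ∀ i, 1 ≤ i ∧ i ≤ n → P (X k n i)) (cross : ∀ i, 1 ≤ i ∧ i < n → P (D k n i))
    (mul : ∀ u v, P u → P v → P (u * v)) (add : ∀ u v, P u → P v → P (u + v))
    (u : ONH k n) : P u := by
  obtain ⟨w, rfl⟩ := mk_surjective u
  induction w using FreeAlgebra.induction with
  | grade0 r => simpa using scalar r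
  | grade1 g =>
    cases g with
    | dot i h => have := dot i h; rwa [X, freeX, dif_pos h] at this
    | cross i h => have := cross i h; rwa [D, freeD, dif_pos h] at this
  | mul a b ha hb => rw [map_mul]; exact mul _ _ ha hb
  | add a b ha hb => rw [map_add]; exact add _ _ ha hb

variable (k n)

/-- The parity involution, `u ↦ (-1)^{p(u)} u`: dots and crossings are odd. -/
def parity : ONH k n →ₐ[k] ONH k n :=
  lift (fun i => -X k n i) (fun i => -D k n i)
    (fun i j _ _ h => by simpa using X_mul_X h)
    (fun i j _ _ h => by simpa using D_mul_D h)
    (fun i _ => by simpa using D_sq i)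
    (fun i _ => by simpa using D_braid i)
    (fun i j _ _ h h' => by simpa using D_mul_X h h')
    (fun i h => by simpa using slide_left h)
    (fun i h => by simpa using slide_right h)

/-- The homomorphism `u ↦ [[(-1)^{p(u)} u, d u], [0, u]]`, which encodes the derivation `d`
with `d (X i) = X i ^ 2` and `d (D i) = 1`. -/
def diffMatrix : ONH k n →ₐ[k] Matrix (Fin 2) (Fin 2) (ONH k n) :=
  lift (fun i => !![-X k n i, X k n i * X k n i; 0, X k n i])
    (fun i => !![-D k n i, 1; 0, D k n i])
    (fun i j _ _ h => by
      have e := X_mul_X (k := k) (n := n) h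
      have e' : X k n j * X k n i = -(X k n i * X k n j) := by
        rw [eq_neg_iff_add_eq_zero, add_comm]; exact e
      ext a b
      fin_cases a <;> fin_cases b <;> simp [e]
      have e1 : X k n j * (X k n i * X k n i) = X k n i * X k n i * X k n j := by
        rw [← mul_assoc, e', neg_mul, mul_assoc, e', mul_neg, neg_neg, mul_assoc]
      have e2 : X k n i * (X k n j * X k n j) = X k n j * X k n j * X k n i := by
        rw [mul_assoc (X k n j), e', mul_neg, ← mul_assoc (X k n j), e', neg_mul, neg_neg,
          mul_assoc]
      rw [e1, e2]; abel)
    (fun i j _ _ h => by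
      have e := D_mul_D (k := k) (n := n) h
      ext a b
      fin_cases a <;> fin_cases b <;> simp [e])
    (fun i _ => by
      have e := D_sq (k := k) (n := n) i
      ext a b
      fin_cases a <;> fin_cases b <;> simp [e])
    (fun i _ => by
      have e := D_braid (k := k) (n := n) i
      have e1 := D_sq (k := k) (n := n) i
      have e2 := D_sq (k := k) (n := n) (i + 1)
      ext a b
      fin_cases a <;> fin_cases b <;>
        simp [e, e1, e2, add_mul]
      abel)
    (fun i j _ _ h h' => by
      have e := D_mul_X (k := k) (n := n) h h'
      have e' : D k n i * X k n j = -(X k n j * D k n i) := by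
        rw [eq_neg_iff_add_eq_zero]; exact e
      ext a b
      fin_cases a <;> fin_cases b <;> simp [e]
      rw [← mul_assoc, e', neg_mul, mul_assoc, e', mul_neg, ← mul_assoc]
      abel)
    (fun i h => by
      have e := slide_left (k := k) (n := n) h
      have e1 : X k n i * D k n i = 1 - D k n i * X k n (i + 1) := by
        rw [eq_sub_iff_add_eq]; exact e
      ext a b
      fin_cases a <;> fin_cases b <;> simp [e]
      rw [mul_assoc, e1, mul_sub, ← mul_assoc, e1, sub_mul]
      noncomm_ring)
    (fun i h => by
      have e := slide_right (k := k) (n := n) h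
      have e1 : D k n i * X k n i = 1 - X k n (i + 1) * D k n i := by
        rw [eq_sub_iff_add_eq]; exact e
      ext a b
      fin_cases a <;> fin_cases b <;> simp [e]
      rw [← mul_assoc, e1, sub_mul, mul_assoc, e1]
      noncomm_ring)

/-- The diagrammatically local differential on the odd nilHecke algebra. -/
def d : ONH k n →ₗ[k] ONH k n where
  toFun u := diffMatrix k n u 0 1
  map_add' u v := by simp
  map_smul' c u := by simp

variable {k n}

theorem parity_X (i : ℕ) : parity k n (X k n i) = -X k n i := by
  by_cases h : 1 ≤ i ∧ i ≤ n
  · exact lift_X _ _ _ _ _ _ _ _ _ h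
  · simp [X_of_not h]

theorem parity_D (i : ℕ) : parity k n (D k n i) = -D k n i := by
  by_cases h : 1 ≤ i ∧ i < n
  · exact lift_D _ _ _ _ _ _ _ _ _ h
  · simp [D_of_not h]

theorem diffMatrix_eq (u : ONH k n) :
    diffMatrix k n u = !![parity k n u, d k n u; 0, u] := by
  suffices h : diffMatrix k n u 0 0 = parity k n u ∧ diffMatrix k n u 1 0 = 0 ∧
      diffMatrix k n u 1 1 = u by
    ext a b
    fin_cases a <;> fin_cases b <;> simp [h, d]
  induction u using induction with
  | scalar c => simp [Matrix.algebraMap_matrix_apply]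
  | dot i h =>
    have : diffMatrix k n (X k n i) = _ := lift_X _ _ _ _ _ _ _ _ _ h
    simp [this, parity_X]
  | cross i h =>
    have : diffMatrix k n (D k n i) = _ := lift_D _ _ _ _ _ _ _ _ _ h
    simp [this, parity_D]
  | mul u v hu hv => simp [Matrix.mul_apply, Fin.sum_univ_two, hu, hv]
  | add u v hu hv => simp [hu, hv]

theorem d_X (i : ℕ) : d k n (X k n i) = X k n i * X k n i := by
  by_cases h : 1 ≤ i ∧ i ≤ n
  · have : diffMatrix k n (X k n i) = _ := lift_X _ _ _ _ _ _ _ _ _ h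
    simp [d, this]
  · simp [X_of_not h]

theorem d_D {i : ℕ} (h : 1 ≤ i ∧ i < n) : d k n (D k n i) = 1 := by
  have : diffMatrix k n (D k n i) = _ := lift_D _ _ _ _ _ _ _ _ _ h
  simp [d, this]

/-- The super Leibniz rule. -/
theorem d_mul (u v : ONH k n) :
    d k n (u * v) = d k n u * v + parity k n u * d k n v := by
  change diffMatrix k n (u * v) 0 1 = _
  rw [map_mul, diffMatrix_eq u, diffMatrix_eq v]
  simp [Matrix.mul_apply, Fin.sum_univ_two, add_comm]

theorem d_algebraMap (c : k) : d k n (algebraMap k _ c) = 0 := by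
  simp [d, Matrix.algebraMap_matrix_apply]

theorem d_parity (u : ONH k n) : d k n (parity k n u) = -parity k n (d k n u) := by
  induction u using induction with
  | scalar c => simp [d_algebraMap]
  | dot i h => simp [parity_X, d_X]
  | cross i h => simp [parity_D, d_D h]
  | mul u v hu hv => simp only [map_mul, d_mul, hu, hv, map_add]; noncomm_ring
  | add u v hu hv => simp only [map_add, hu, hv]; abel

theorem d_d (u : ONH k n) : d k n (d k n u) = 0 := by
  induction u using induction with
  | scalar c => simp [d_algebraMap]
  | dot i h => simp [d_X, d_mul, parity_X, mul_assoc]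
  | cross i h => simpa [d_D h] using d_algebraMap (k := k) (n := n) 1
  | mul u v hu hv => simp [d_mul, hu, hv, d_parity]
  | add u v hu hv => simp [hu, hv]

variable (k n)

/-- `∂_{w_0} = ∂_1 (∂_2 ∂_1) ⋯ (∂_{n-1} ⋯ ∂_1)`. -/
def longest : ONH k n :=
  ((List.range n).map fun m => ((List.range m).map fun j => D k n (m - j)).prod).prod

/-- `x^δ = x_1^{n-1} x_2^{n-2} ⋯ x_{n-1}`. -/
def staircase : ONH k n :=
  ((List.range n).map fun j => X k n (j + 1) ^ (n - 1 - j)).prod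

/-- The idempotent `e_n = (-1)^{n choose 3} ∂_{w_0} x^δ`; it is the identity of the strand of
thickness `n`. -/
def thick : ONH k n := (-1) ^ n.choose 3 * longest k n * staircase k n

/-- The first twisted odd elementary symmetric polynomial
`x_1 - x_2 + x_3 - ⋯ + (-1)^{n-1} x_n`. -/
def twistedE1 : ONH k n := ∑ i ∈ Finset.Icc 1 n, (-1) ^ (i - 1) * X k n i

variable {n}

/-- A strand of thickness `n` with the label `f`. -/
def label (f : ONH k n) : ONH k n := thick k n * f * thick k n

end

section

variable (k : Type*) [CommRing k] (a b : ℕ)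

/-- Add `b` vertical strands on the right of a diagram on `a` strands. -/
def addRight : ONH k a →ₐ[k] ONH k (a + b) :=
  lift (fun i => X k (a + b) i) (fun i => D k (a + b) i)
    (fun _ _ _ _ h => X_mul_X h) (fun _ _ _ _ h => D_mul_D h) (fun i _ => D_sq i)
    (fun i _ => D_braid i) (fun _ _ _ _ h h' => D_mul_X h h')
    (fun _ h => slide_left (by omega)) (fun _ h => slide_right (by omega))

/-- Add `a` vertical strands on the left of a diagram on `b` strands. -/
def addLeft : ONH k b →ₐ[k] ONH k (a + b) :=
  lift (fun i => X k (a + b) (a + i)) (fun i => D k (a + b) (a + i))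
    (fun _ _ _ _ h => X_mul_X (by omega)) (fun _ _ _ _ h => D_mul_D (by omega))
    (fun i _ => D_sq (a + i)) (fun i _ => D_braid (a + i))
    (fun _ _ _ _ h h' => D_mul_X (by omega) (by omega))
    (fun _ h => slide_left (by omega)) (fun _ h => slide_right (by omega))

variable {k a b}

/-- Horizontal juxtaposition, with the left diagram above the right one. -/
def juxt (u : ONH k a) (v : ONH k b) : ONH k (a + b) := addRight k a b u * addLeft k a b v

variable (k a b)

/-- The crossing of a bunch of `a` strands, going from bottom left to top right, with a bunch
of `b` strands, going from bottom right to top left: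
`(∂_b ⋯ ∂_1) (∂_{b+1} ⋯ ∂_2) ⋯ (∂_{a+b-1} ⋯ ∂_a)`. -/
def bunchCross : ONH k (a + b) :=
  ((List.range a).map fun j =>
    ((List.range b).map fun l => D k (a + b) (b + j - l)).prod).prod

/-- Two parallel strands of thickness `a` and `b`. -/
def thickPair : ONH k (a + b) := juxt (thick k a) (thick k b)

/-- The splitter, from one strand of thickness `a + b` at the bottom to strands of thickness
`a`, `b` at the top. -/
def splitter : ONH k (a + b) := thickPair k a b * thick k (a + b)

/-- The merge, from strands of thickness `a`, `b` at the bottom to one strand of thickness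
`a + b` at the top. -/
def merge : ONH k (a + b) := thick k (a + b) * bunchCross k a b * thickPair k a b

end

/-- The differential of a thick diagram `s` whose top boundary is the idempotent `e`. The
diagrams with top `e` and bottom `f` are the elements of `e ONH f`, where `s` stands for the left
module homomorphism `ONH e → ONH f`, `m ↦ (-1)^{p(s)p(m)} m * s`; the differential that the one
on `ONH` induces on these homomorphisms is `s ↦ e * d s` (see `mul_thickDiff`). -/
def thickDiff {k : Type*} [CommRing k] {n : ℕ} (e s : ONH k n) : ONH k n := e * d k n s

/-- `thickDiff e s` represents the commutator of the differential with right multiplication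
by `s` on the left ideal `ONH e`, for an even idempotent `e`. -/
theorem mul_thickDiff {k : Type*} [CommRing k] {n : ℕ} (e s m : ONH k n)
    (he : parity k n e = e) (hm : m * e = m) :
    d k n (m * s) - d k n m * s = parity k n m * thickDiff e s := by
  have h : parity k n m * e = parity k n m := by
    conv_rhs => rw [← hm, map_mul, he]
  rw [d_mul, add_sub_cancel_left, thickDiff, ← mul_assoc, h]

/-- `{m}`, which is `0` for even and `1` for odd `m`. -/
def brace (m : ℤ) : ℤ := if Even m then 0 else 1

end OddThick

end

/-! Everything rests on two facts about the idempotent `e_n`. Any element killed on the left by all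
crossings is fixed by left multiplication with `e_n` (`thickWord_mul`). Its differential is a left
multiple of it: `d e_n = P_n e_n` with `P_n = x_2 + x_4 + ⋯` (`d_thickWord`). The latter follows
from `d (∂_{w_0}) = P_n ∂_{w_0} ∓ ∂_{w_0} Q_n` and `d (x^δ) = Q_n x^δ` with `Q_n = x_{n-1} + x_{n-3}
+ ⋯`, because the two `Q_n` terms cancel. The Leibniz rule applied to `e_n e_n = e_n` then gives
`e_n P_n e_n = 0`.

Splitter: `e_a ⊠ e_b` is absorbed by `e_{a+b}`, so the splitter is `e_{a+b}` itself, with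
differential `P_{a+b} e_{a+b}`. Cut `P_{a+b}` after strand `a`. It is `P` of each block, which the
top idempotents kill, plus, for odd `a`, the alternating sum of the second block. That remainder is
the label on the `b`-leg.

Merge: `∂_{a,b}` times the longest words of the two blocks is a scalar times the longest word on `a
+ b` strands (`bunchCross_mul_longestWord`). Up to a scalar the merge is thus `∂_{w_0}` times the
two staircases. On applying `d`, the `P` term dies under `e_{a+b}`. What remains compares `Q_{a+b}`
with the sum of the `Q` of the blocks, and the difference is, for odd `b`, the alternating sum of
the first block up to sign. On the other side of the identity, the label slides to the same place
through the longest words (`altSum_mul_longestWord`), which produces the sign `(-1)^{ab-1}`. The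
scalar occurs on both sides and is never computed. -/

namespace OddThick

/-! ### Words in dots and crossings, and how letters move through them -/

section Words

variable {R : Type*} [Ring R]

/-- The relations of the odd nilHecke algebra on `n` strands, for dots `x` and crossings `y`. -/
structure IsONH (n : ℕ) (x y : ℕ → R) : Prop where
  xx : ∀ i j, 1 ≤ i → i ≤ n → 1 ≤ j → j ≤ n → i ≠ j → x i * x j = -(x j * x i)
  yy : ∀ i j, 1 ≤ i → i < n → 1 ≤ j → j < n → i + 1 < j ∨ j + 1 < i → y i * y j = -(y j * y i)
  sq : ∀ i, 1 ≤ i → i < n → y i * y i = 0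
  braid : ∀ i, 1 ≤ i → i + 1 < n → y i * y (i + 1) * y i = y (i + 1) * y i * y (i + 1)
  yx : ∀ i j, 1 ≤ i → i < n → 1 ≤ j → j ≤ n → j ≠ i → j ≠ i + 1 → y i * x j = -(x j * y i)
  left : ∀ i, 1 ≤ i → i < n → x i * y i = 1 - y i * x (i + 1)
  right : ∀ i, 1 ≤ i → i < n → y i * x i = 1 - x (i + 1) * y i

theorem IsONH.mono {n m : ℕ} {x y : ℕ → R} (h : IsONH n x y) (hm : m ≤ n) : IsONH m x y where
  xx i j h1 h2 h3 h4 := h.xx i j h1 (by omega) h3 (by omega)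
  yy i j h1 h2 h3 h4 := h.yy i j h1 (by omega) h3 (by omega)
  sq i h1 h2 := h.sq i h1 (by omega)
  braid i h1 h2 := h.braid i h1 (by omega)
  yx i j h1 h2 h3 h4 := h.yx i j h1 (by omega) h3 (by omega)
  left i h1 h2 := h.left i h1 (by omega)
  right i h1 h2 := h.right i h1 (by omega)

/-- Together with `IsONH.mono`, this restricts the relations to a block of consecutive strands, so
inductions on the number of strands and juxtaposed diagrams stay inside one ring. -/
theorem IsONH.shift {n a b : ℕ} {x y : ℕ → R} (h : IsONH n x y) (hn : a + b ≤ n) :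
    IsONH b (fun i => x (a + i)) (fun i => y (a + i)) where
  xx i j h1 h2 h3 h4 h5 := h.xx _ _ (by omega) (by omega) (by omega) (by omega) (by omega)
  yy i j h1 h2 h3 h4 h5 := h.yy _ _ (by omega) (by omega) (by omega) (by omega) (by omega)
  sq i h1 h2 := h.sq _ (by omega) (by omega)
  braid i h1 h2 := h.braid _ (by omega) (by omega)
  yx i j h1 h2 h3 h4 h5 h6 :=
    h.yx _ _ (by omega) (by omega) (by omega) (by omega) (by omega) (by omega)
  left i h1 h2 := h.left _ (by omega) (by omega)
  right i h1 h2 := h.right _ (by omega) (by omega)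

theorem IsONH.left' {n : ℕ} {x y : ℕ → R} (h : IsONH n x y) {i : ℕ} (h1 : 1 ≤ i) (h2 : i < n) :
    y i * x (i + 1) = 1 - x i * y i := by
  rw [h.left i h1 h2]; abel

theorem IsONH.right' {n : ℕ} {x y : ℕ → R} (h : IsONH n x y) {i : ℕ} (h1 : 1 ≤ i) (h2 : i < n) :
    x (i + 1) * y i = 1 - y i * x i := by
  rw [h.right i h1 h2]; abel

/-- The descending product `y_m ⋯ y_1`. -/
def chain (y : ℕ → R) (m : ℕ) : R := ((List.range m).map fun j => y (m - j)).prod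

/-- The ascending product `y_1 ⋯ y_m`. -/
def ascChain (y : ℕ → R) (m : ℕ) : R := ((List.range m).map fun j => y (j + 1)).prod

/-- The word `y_1 (y_2 y_1) ⋯ (y_{n-1} ⋯ y_1)` of the longest permutation. -/
def longestWord (y : ℕ → R) (n : ℕ) : R := ((List.range n).map (chain y)).prod

/-- The word `x_1^{n-1} x_2^{n-2} ⋯ x_{n-1}`. -/
def stairWord (x : ℕ → R) (n : ℕ) : R :=
  ((List.range n).map fun j => x (j + 1) ^ (n - 1 - j)).prod

@[simp] theorem chain_zero (y : ℕ → R) : chain y 0 = 1 := by simp [chain]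

theorem chain_succ (y : ℕ → R) (m : ℕ) : chain y (m + 1) = y (m + 1) * chain y m := by
  simp [chain, List.range_succ_eq_map, Function.comp_def]

theorem chain_succ' (y : ℕ → R) (m : ℕ) :
    chain y (m + 1) = chain (fun i => y (1 + i)) m * y 1 := by
  induction m with
  | zero => simp [chain_succ]
  | succ m ih => rw [chain_succ, ih, chain_succ _ m, mul_assoc, add_comm 1]

theorem chain_add (y : ℕ → R) (a b : ℕ) :
    chain y (a + b) = chain (fun i => y (a + i)) b * chain y a := by
  induction b with
  | zero => simp
  | succ b ih => rw [← add_assoc, chain_succ, ih, chain_succ _ b, mul_assoc, add_assoc]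

@[simp] theorem ascChain_zero (y : ℕ → R) : ascChain y 0 = 1 := by simp [ascChain]

theorem ascChain_succ (y : ℕ → R) (m : ℕ) : ascChain y (m + 1) = ascChain y m * y (m + 1) := by
  simp [ascChain, List.range_succ]

theorem ascChain_succ' (y : ℕ → R) (m : ℕ) :
    ascChain y (m + 1) = y 1 * ascChain (fun i => y (1 + i)) m := by
  simp [ascChain, List.range_succ_eq_map, Function.comp_def, add_comm 1]

@[simp] theorem longestWord_zero (y : ℕ → R) : longestWord y 0 = 1 := by simp [longestWord]

theorem longestWord_succ (y : ℕ → R) (n : ℕ) :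
    longestWord y (n + 1) = longestWord y n * chain y n := by
  simp [longestWord, List.range_succ]

@[simp] theorem stairWord_zero (x : ℕ → R) : stairWord x 0 = 1 := by simp [stairWord]

theorem stairWord_succ (x : ℕ → R) (n : ℕ) :
    stairWord x (n + 1) = x 1 ^ n * stairWord (fun i => x (1 + i)) n := by
  simp only [stairWord, List.range_succ_eq_map, List.map_cons, List.map_map, List.prod_cons,
    Function.comp_def]
  congr 2
  refine List.map_congr_left fun j _ => ?_
  rw [show n + 1 - 1 - (j.succ) = n - 1 - j by omega, add_comm 1]

theorem choose_two_succ (n : ℕ) : (n + 1).choose 2 = n.choose 2 + n := by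
  rw [Nat.choose_succ_succ' n 1, Nat.choose_one_right, add_comm]

theorem choose_three_succ (n : ℕ) : (n + 1).choose 3 = n.choose 3 + n.choose 2 := by
  rw [Nat.choose_succ_succ' n 2, add_comm]

/-- Signs commute past words letter by letter. -/
theorem chain_mul_of_intertwine {y y' : ℕ → R} {z : R} {ε : ℤ} {m : ℕ}
    (h : ∀ i, 1 ≤ i → i ≤ m → y' i * z = ε • (z * y i)) :
    chain y' m * z = ε ^ m • (z * chain y m) := by
  induction m with
  | zero => simp
  | succ m ih =>
    rw [chain_succ, chain_succ, mul_assoc, ih fun i h1 h2 => h i h1 (by omega), mul_smul_comm,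
      ← mul_assoc, h _ (by omega) le_rfl, smul_mul_assoc, smul_smul, mul_assoc, pow_succ]

theorem ascChain_mul_of_intertwine {y y' : ℕ → R} {z : R} {ε : ℤ} {m : ℕ}
    (h : ∀ i, 1 ≤ i → i ≤ m → y' i * z = ε • (z * y i)) :
    ascChain y' m * z = ε ^ m • (z * ascChain y m) := by
  induction m with
  | zero => simp
  | succ m ih =>
    rw [ascChain_succ, ascChain_succ, mul_assoc, h _ (by omega) le_rfl, mul_smul_comm,
      ← mul_assoc, ih fun i h1 h2 => h i h1 (by omega), smul_mul_assoc, smul_smul, mul_assoc,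
      pow_succ']

theorem longestWord_mul_of_intertwine {y y' : ℕ → R} {z : R} {ε : ℤ} {n : ℕ}
    (h : ∀ i, 1 ≤ i → i < n → y' i * z = ε • (z * y i)) :
    longestWord y' n * z = ε ^ n.choose 2 • (z * longestWord y n) := by
  induction n with
  | zero => simp
  | succ n ih =>
    rw [longestWord_succ, longestWord_succ, mul_assoc,
      chain_mul_of_intertwine fun i h1 h2 => h i h1 (by omega), mul_smul_comm,
      ← mul_assoc, ih fun i h1 h2 => h i h1 (by omega), smul_mul_assoc, smul_smul, mul_assoc,
      choose_two_succ, pow_add, mul_comm (ε ^ n)]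

theorem pow_mul_of_intertwine {x z : R} {ε : ℤ} (h : x * z = ε • (z * x)) (m : ℕ) :
    x ^ m * z = ε ^ m • (z * x ^ m) := by
  induction m with
  | zero => simp
  | succ m ih =>
    rw [pow_succ, mul_assoc, h, mul_smul_comm, ← mul_assoc, ih, smul_mul_assoc, smul_smul,
      mul_assoc, pow_succ']

theorem stairWord_mul_of_intertwine {x : ℕ → R} {z : R} {ε : ℤ} {n : ℕ}
    (h : ∀ i, 1 ≤ i → i ≤ n → x i * z = ε • (z * x i)) :
    stairWord x n * z = ε ^ n.choose 2 • (z * stairWord x n) := by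
  induction n generalizing x with
  | zero => simp
  | succ n ih =>
    rw [stairWord_succ, mul_assoc, ih fun i h1 h2 => h (1 + i) (by omega) (by omega),
      mul_smul_comm, ← mul_assoc, pow_mul_of_intertwine (h 1 le_rfl (by omega)), smul_mul_assoc,
      smul_smul, mul_assoc, choose_two_succ, pow_add]

variable {n : ℕ} {x y : ℕ → R}

/-- A second factorization, with the new letters on the left: the top letter of the last chain is
far from all letters of the preceding longest word and passes it at the cost of signs. It is needed
for arguments that act from the left. -/
theorem longestWord_succ_eq_ascChain_mul (h : IsONH (n + 1) x y) :
    longestWord y (n + 1) = (-1 : ℤ) ^ n.choose 3 • (ascChain y n * longestWord y n) := by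
  induction n with
  | zero => simp [longestWord_succ]
  | succ n ih =>
    have e : longestWord y n * y (n + 1) =
        (-1 : ℤ) ^ n.choose 2 • (y (n + 1) * longestWord y n) :=
      longestWord_mul_of_intertwine fun i h1 h2 => by
        rw [h.yy i (n + 1) h1 (by omega) (by omega) (by omega) (by omega)]; simp
    conv_lhs => rw [longestWord_succ, ih (h.mono (by omega)), chain_succ, smul_mul_assoc,
      mul_assoc, ← mul_assoc (longestWord y n), e, smul_mul_assoc, mul_smul_comm, smul_smul,
      mul_assoc, ← longestWord_succ, ← mul_assoc, ← ascChain_succ]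
    rw [choose_three_succ, pow_add]

/-- Crossings slide through a chain. -/
theorem chain_mul_cross {m i : ℕ} (h : IsONH n x y) (hm : m < n) (hi : 1 ≤ i) (him : i + 1 ≤ m) :
    chain y m * y (i + 1) = (-1 : ℤ) ^ m • (y i * chain y m) := by
  induction m with
  | zero => omega
  | succ m ih =>
    obtain h1 | rfl : i + 1 ≤ m ∨ m = i := by omega
    · rw [chain_succ, mul_assoc, ih (by omega) h1, mul_smul_comm, ← mul_assoc,
        h.yy (m + 1) i (by omega) hm hi (by omega) (by omega), neg_mul, mul_assoc, smul_neg,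
        pow_succ]
      simp
    · obtain ⟨m, rfl⟩ : ∃ l, m = l + 1 := ⟨m - 1, by omega⟩
      have e : chain y m * y (m + 1 + 1) = (-1 : ℤ) ^ m • (y (m + 1 + 1) * chain y m) :=
        chain_mul_of_intertwine fun i h1 h2 => by
          rw [h.yy i (m + 1 + 1) h1 (by omega) (by omega) (by omega) (by omega)]; simp
      rw [chain_succ, chain_succ, mul_assoc, mul_assoc, e, mul_smul_comm, mul_smul_comm,
        ← mul_assoc, ← mul_assoc, ← h.braid (m + 1) (by omega) hm]
      simp [pow_succ, mul_assoc]

/-- The last chain ends in `y 1`, which settles `i = 1`. Any other crossing passes the chain with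
its index lowered by one and meets the shorter longest word. -/
theorem longestWord_mul_cross {i : ℕ} (h : IsONH n x y) (hi : 1 ≤ i) (hin : i < n) :
    longestWord y n * y i = 0 := by
  induction n generalizing i with
  | zero => omega
  | succ n ih =>
    rw [longestWord_succ, mul_assoc]
    obtain rfl | ⟨j, rfl, hj⟩ : i = 1 ∨ ∃ j, i = j + 1 ∧ 1 ≤ j := by
      rcases Nat.lt_or_ge 1 i with h1 | h1
      · exact Or.inr ⟨i - 1, by omega, by omega⟩
      · exact Or.inl (by omega)
    · obtain ⟨m, rfl⟩ : ∃ m, n = m + 1 := ⟨n - 1, by omega⟩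
      rw [chain_succ', mul_assoc, h.sq 1 le_rfl hin, mul_zero, mul_zero]
    · rw [chain_mul_cross h (by omega) hj (by omega), mul_smul_comm, ← mul_assoc,
        ih (h.mono (by omega)) hj (by omega), zero_mul, smul_zero]

theorem cross_mul_longestWord {i : ℕ} (h : IsONH n x y) (hi : 1 ≤ i) (hin : i < n) :
    y i * longestWord y n = 0 := by
  induction n generalizing i with
  | zero => omega
  | succ n ih =>
    obtain h1 | rfl : i < n ∨ i = n := by omega
    · rw [longestWord_succ, ← mul_assoc, ih (h.mono (by omega)) hi h1, zero_mul]
    · rw [longestWord_succ_eq_ascChain_mul h, mul_smul_comm, ← mul_assoc]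
      suffices hs : y i * ascChain y i * longestWord y i = 0 by rw [hs, smul_zero]
      obtain ⟨m, rfl⟩ : ∃ m, i = m + 1 := ⟨i - 1, by omega⟩
      rcases m with _ | m
      · simp [ascChain_succ, h.sq 1 le_rfl hin]
      · have e : ascChain y m * y (m + 1 + 1) = (-1 : ℤ) ^ m • (y (m + 1 + 1) * ascChain y m) :=
          ascChain_mul_of_intertwine fun i h1 h2 => by
            rw [h.yy i (m + 1 + 1) h1 (by omega) (by omega) (by omega) (by omega)]; simp
        have e' : y (m + 1 + 1) * ascChain y m = (-1 : ℤ) ^ m • (ascChain y m * y (m + 1 + 1)) := by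
          rw [e, smul_smul, ← mul_pow]; simp
        -- The braid relation turns the three letters around, so that `y (m + 1)` meets the longest
        -- word and kills it.
        have e2 : y (m + 1 + 1) * (y (m + 1) * (y (m + 1 + 1) * longestWord y (m + 1 + 1))) = 0 := by
          rw [← mul_assoc, ← mul_assoc, ← h.braid (m + 1) (by omega) hin, mul_assoc,
            ih (h.mono (by omega)) (by omega) (by omega), mul_zero]
        rw [ascChain_succ, ascChain_succ, mul_assoc (ascChain y m), ← mul_assoc (y (m + 1 + 1)),
          e', smul_mul_assoc, smul_mul_assoc, mul_assoc, mul_assoc, mul_assoc, e2, mul_zero,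
          smul_zero]

/-! ### Dots through chains -/

/-- The dot meets the crossing `y j` and moves one strand to the right. The correction term deletes
`y j`, which frees `y (j - 1)` to move left up to `u`, where it vanishes. -/
theorem mul_dot_mul_chain {m j : ℕ} {u : R} (h : IsONH (m + 1) x y)
    (hu : ∀ i, 1 ≤ i → i < m → u * y i = 0) (hj : 2 ≤ j) (hjm : j ≤ m) :
    u * x j * chain y m = (-1 : ℤ) ^ m • (u * chain y m * x (j + 1)) := by
  induction m generalizing u with
  | zero => omega
  | succ m ih =>
    have hu' : ∀ i, 1 ≤ i → i < m → u * y (m + 1) * y i = 0 := fun i h1 h2 => by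
      rw [mul_assoc, h.yy (m + 1) i (by omega) (by omega) h1 (by omega) (by omega), mul_neg,
        ← mul_assoc, hu i h1 (by omega), zero_mul, neg_zero]
    obtain h1 | rfl : j ≤ m ∨ j = m + 1 := by omega
    · have e : x j * y (m + 1) = -(y (m + 1) * x j) := by
        rw [h.yx (m + 1) j (by omega) (by omega) (by omega) (by omega) (by omega) (by omega),
          neg_neg]
      have := ih (h.mono (by omega)) hu' h1
      rw [chain_succ, ← mul_assoc, mul_assoc u, e, mul_neg, neg_mul, ← mul_assoc u, this,
        pow_succ]
      simp [mul_assoc]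
    · obtain ⟨l, rfl⟩ : ∃ l, m = l + 1 := ⟨m - 1, by omega⟩
      have e0 : u * chain y (l + 1) = 0 := by
        rw [chain_succ, ← mul_assoc, hu _ (by omega) (by omega), zero_mul]
      have e1 : chain y (l + 1) * x (l + 1 + 1 + 1) =
          (-1 : ℤ) ^ (l + 1) • (x (l + 1 + 1 + 1) * chain y (l + 1)) :=
        chain_mul_of_intertwine fun i h1 h2 => by
          rw [h.yx i _ h1 (by omega) (by omega) (by omega) (by omega) (by omega)]; simp
      rw [chain_succ y (l + 1), ← mul_assoc, mul_assoc u, h.left _ (by omega) (by omega), mul_sub,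
        mul_one, sub_mul, e0, mul_assoc, mul_assoc (y _), mul_assoc, mul_assoc (y _), e1,
        mul_smul_comm, mul_smul_comm, smul_smul, pow_succ _ (l + 1)]
      have : ((-1 : ℤ) ^ (l + 1) * -1 * (-1) ^ (l + 1)) = -1 := by
        rw [mul_right_comm, ← mul_pow]; simp
      rw [this]; simp

/-- For the first dot the deleted letter is the last one, `y 1`. Nothing to its right can move to
`u`, so the correction survives. -/
theorem mul_dot_one_mul_chain {m : ℕ} (u : R) (h : IsONH (m + 2) x y) :
    u * x 1 * chain y (m + 1) = (-1 : ℤ) ^ (m + 1) • (u * chain y (m + 1) * x 2) +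
      (-1 : ℤ) ^ m • (u * chain (fun i => y (1 + i)) m) := by
  induction m generalizing u with
  | zero =>
    simp only [chain_succ, chain_zero, mul_one, zero_add, mul_assoc, pow_one, pow_zero, one_smul]
    rw [h.left 1 le_rfl (by omega)]
    simp [mul_sub]; abel
  | succ m ih =>
    have e : x 1 * y (m + 1 + 1) = -(y (m + 1 + 1) * x 1) := by
      rw [h.yx (m + 1 + 1) 1 (by omega) (by omega) (by omega) (by omega) (by omega) (by omega),
        neg_neg]
    have := ih (u * y (m + 1 + 1)) (h.mono (by omega))
    rw [chain_succ y (m + 1), ← mul_assoc, mul_assoc u, e, mul_neg, neg_mul, ← mul_assoc u, this,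
      chain_succ (fun i => y (1 + i)) m, add_comm 1 (m + 1), pow_succ _ (m + 1), pow_succ _ m]
    simp [mul_assoc]
    abel

/-- The last dot follows the long strand of the chain and meets every crossing. All corrections die
on `u` except the one deleting `y 1`, which is the same correction as for the first dot. -/
theorem mul_dot_last_mul_chain {m : ℕ} {u : R} (h : IsONH (m + 2) x y)
    (hu : ∀ i, 1 ≤ i → i < m + 1 → u * y i = 0) :
    u * x (m + 2) * chain y (m + 1) = (-1 : ℤ) ^ (m + 1) • (u * chain y (m + 1) * x 1) +
      (-1 : ℤ) ^ m • (u * chain (fun i => y (1 + i)) m) := by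
  induction m generalizing u with
  | zero =>
    simp only [chain_succ, chain_zero, mul_one, zero_add, mul_assoc, pow_one, pow_zero, one_smul]
    rw [h.right' le_rfl (by omega)]
    simp [mul_sub]; abel
  | succ m ih =>
    have hu' : ∀ i, 1 ≤ i → i < m + 1 → u * y (m + 2) * y i = 0 := fun i h1 h2 => by
      rw [mul_assoc, h.yy (m + 2) i (by omega) (by omega) h1 (by omega) (by omega), mul_neg,
        ← mul_assoc, hu i h1 (by omega), zero_mul, neg_zero]
    have e0 : u * chain y (m + 1) = 0 := by
      rw [chain_succ, ← mul_assoc, hu _ (by omega) (by omega), zero_mul]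
    have := ih (h.mono (by omega)) hu'
    rw [chain_succ y (m + 1), ← mul_assoc, mul_assoc u, h.right' (by omega) (by omega), mul_sub,
      mul_one, sub_mul, e0, ← mul_assoc u, this,
      chain_succ (fun i => y (1 + i)) m, add_comm 1 (m + 1), pow_succ _ (m + 1), pow_succ _ m]
    simp [mul_assoc]
    abel

end Words

/-! ### The thick idempotent and sums of dots -/

section Thick

variable {R : Type*} [Ring R] {n : ℕ} {x y : ℕ → R}

/-- The product `x_1 ⋯ x_n` is moved out of the staircase. -/
theorem stairWord_succ_eq_ascChain_mul (h : IsONH (n + 1) x y) :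
    stairWord x (n + 1) = (-1 : ℤ) ^ n.choose 2 • (ascChain x n * stairWord x n) := by
  induction n generalizing x y with
  | zero => simp [stairWord_succ]
  | succ n ih =>
    have e : ascChain (fun i => x (1 + i)) n * x 1 =
        (-1 : ℤ) ^ n • (x 1 * ascChain (fun i => x (1 + i)) n) :=
      ascChain_mul_of_intertwine fun i h1 h2 => by
        rw [h.xx (1 + i) 1 (by omega) (by omega) (by omega) (by omega) (by omega)]; simp
    have e' : x 1 * ascChain (fun i => x (1 + i)) n =
        (-1 : ℤ) ^ n • (ascChain (fun i => x (1 + i)) n * x 1) := by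
      rw [e, smul_smul, ← mul_pow]; simp
    have e2 : ascChain (fun i => x (1 + i)) n * x 1 ^ n =
        (-1 : ℤ) ^ n • (x 1 ^ n * ascChain (fun i => x (1 + i)) n) := by
      rw [pow_mul_of_intertwine e']
      rcases Nat.even_or_odd n with hn | hn <;> simp [hn.neg_one_pow]
    rw [stairWord_succ, ih (h.shift (a := 1) (by omega)), stairWord_succ x n, ascChain_succ' x n,
      choose_two_succ, pow_add (-1 : ℤ), mul_smul_comm, mul_assoc (x 1), ← mul_assoc (ascChain _ n), e2,
      smul_mul_assoc, mul_smul_comm, smul_smul, mul_assoc ((-1 : ℤ) ^ _), ← mul_pow,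
      pow_succ' (x 1) n]
    simp [mul_assoc]

/-- The pair `x i * x (i + 1)` passes `y i` with a single sign, the two correction terms cancelling.
The other `n - 2` dots give one sign each. -/
theorem cross_mul_ascChain_dot {i : ℕ} (h : IsONH n x y) (hi : 1 ≤ i) (hin : i < n) :
    y i * ascChain x n = (-1 : ℤ) ^ (n + 1) • (ascChain x n * y i) := by
  induction n with
  | zero => omega
  | succ n ih =>
    rw [ascChain_succ]
    obtain h1 | rfl : i < n ∨ i = n := by omega
    · rw [← mul_assoc, ih (h.mono (by omega)) h1, smul_mul_assoc, mul_assoc,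
        h.yx i (n + 1) hi (by omega) (by omega) le_rfl (by omega) (by omega), pow_succ _ (n + 1)]
      simp [mul_assoc]
    · obtain ⟨m, rfl⟩ : ∃ m, i = m + 1 := ⟨i - 1, by omega⟩
      have e : ascChain x m * y (m + 1) = (-1 : ℤ) ^ m • (y (m + 1) * ascChain x m) :=
        ascChain_mul_of_intertwine fun i h1 h2 => by
          rw [h.yx (m + 1) i (by omega) (by omega) h1 (by omega) (by omega) (by omega)]; simp
      have e' : y (m + 1) * ascChain x m = (-1 : ℤ) ^ m • (ascChain x m * y (m + 1)) := by
        rw [e, smul_smul, ← mul_pow]; simp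
      have e2 : y (m + 1) * (x (m + 1) * x (m + 1 + 1)) =
          -(x (m + 1) * x (m + 1 + 1) * y (m + 1)) := by
        rw [← mul_assoc, h.right _ hi hin, sub_mul, one_mul, mul_assoc, h.left' hi hin, mul_sub,
          ← mul_assoc, h.xx (m + 1 + 1) (m + 1) (by omega) (by omega) (by omega) (by omega)
            (by omega)]
        simp
      rw [ascChain_succ, mul_assoc (ascChain x m), ← mul_assoc (y _), e', smul_mul_assoc,
        mul_assoc, e2, pow_succ, pow_succ, pow_succ]
      simp [mul_assoc]

/-- On `u` each crossing undoes the dot of the same index: `y i * x i * u = u`, as `y i` kills `u`.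
The sign comes from moving the crossings past the other dots. -/
theorem ascChain_mul_ascChain_dot {u : R} (h : IsONH (n + 1) x y)
    (hu : ∀ i, 1 ≤ i → i < n + 1 → y i * u = 0) :
    ascChain y n * ascChain x n * u = (-1 : ℤ) ^ n.choose 2 • u := by
  induction n with
  | zero => simp
  | succ n ih =>
    have e : ascChain x n * y (n + 1) = (-1 : ℤ) ^ n • (y (n + 1) * ascChain x n) :=
      ascChain_mul_of_intertwine fun i h1 h2 => by
        rw [h.yx (n + 1) i (by omega) (by omega) h1 (by omega) (by omega) (by omega)]; simp
    have e' : y (n + 1) * ascChain x n = (-1 : ℤ) ^ n • (ascChain x n * y (n + 1)) := by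
      rw [e, smul_smul, ← mul_pow]; simp
    have e2 : y (n + 1) * (x (n + 1) * u) = u := by
      rw [← mul_assoc, h.right _ (by omega) (by omega), sub_mul, one_mul, mul_assoc,
        hu _ (by omega) (by omega), mul_zero, sub_zero]
    have := ih (h.mono (by omega)) fun i h1 h2 => hu i h1 (by omega)
    rw [ascChain_succ, ascChain_succ, mul_assoc, mul_assoc (ascChain y n), mul_assoc (ascChain x n),
      ← mul_assoc (y (n + 1)), e', smul_mul_assoc, mul_assoc (ascChain x n), e2, mul_smul_comm,
      ← mul_assoc, this, smul_smul, ← pow_add, choose_two_succ, add_comm n]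

/-- The idempotent of a thick strand, for dots `x` and crossings `y`. -/
def thickWord (x y : ℕ → R) (n : ℕ) : R :=
  (-1 : ℤ) ^ n.choose 3 • (longestWord y n * stairWord x n)

/-- The thick strand fixes everything that is killed by all crossings. -/
theorem thickWord_mul {u : R} (h : IsONH n x y) (hu : ∀ i, 1 ≤ i → i < n → y i * u = 0) :
    thickWord x y n * u = u := by
  induction n with
  | zero => simp [thickWord]
  | succ n ih =>
    have e : longestWord y n * ascChain x n =
        ((-1 : ℤ) ^ (n + 1)) ^ n.choose 2 • (ascChain x n * longestWord y n) :=
      longestWord_mul_of_intertwine fun i h1 h2 =>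
        cross_mul_ascChain_dot (h.mono (by omega)) h1 h2
    have h1 := ih (h.mono (by omega)) fun i h1 h2 => hu i h1 (by omega)
    have h2 := ascChain_mul_ascChain_dot h hu
    have h3 : longestWord y n * (stairWord x n * u) = (-1 : ℤ) ^ n.choose 3 • u := by
      conv_rhs => rw [← h1, thickWord]
      rw [smul_mul_assoc, smul_smul, ← mul_pow, mul_assoc]; simp
    rw [thickWord, longestWord_succ_eq_ascChain_mul h, stairWord_succ_eq_ascChain_mul h]
    simp only [smul_mul_assoc, mul_smul_comm, smul_smul]
    rw [mul_assoc, mul_assoc (ascChain y n), mul_assoc (ascChain x n),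
      ← mul_assoc (longestWord y n), e, smul_mul_assoc, mul_smul_comm, mul_assoc (ascChain x n),
      h3, mul_smul_comm, mul_smul_comm, ← mul_assoc (ascChain y n), h2]
    simp only [smul_smul]
    -- The exponent `(n + 1) * n.choose 2` from exchanging the two words equals `3 * (n + 1).choose
    -- 3`. With it all exponents add up to an even number.
    have hs := Nat.add_one_mul_choose_eq n 2
    rw [← pow_mul, hs, choose_three_succ]
    simp only [← pow_add]
    rw [Even.neg_one_pow ⟨3 * n.choose 3 + 3 * n.choose 2, by ring⟩, one_smul]

theorem cross_mul_thickWord {i : ℕ} (h : IsONH n x y) (hi : 1 ≤ i) (hin : i < n) :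
    y i * thickWord x y n = 0 := by
  rw [thickWord, mul_smul_comm, ← mul_assoc, cross_mul_longestWord h hi hin, zero_mul, smul_zero]

theorem thickWord_mul_thickWord (h : IsONH n x y) :
    thickWord x y n * thickWord x y n = thickWord x y n :=
  thickWord_mul h fun _ h1 h2 => cross_mul_thickWord h h1 h2

theorem thickWord_mul_longestWord (h : IsONH n x y) :
    thickWord x y n * longestWord y n = longestWord y n :=
  thickWord_mul h fun _ h1 h2 => cross_mul_longestWord h h1 h2

/-- The sum `x_1 - x_2 + ⋯ + (-1)^{n-1} x_n`. -/
def altSum (x : ℕ → R) (n : ℕ) : R := ∑ i ∈ Finset.range n, (-1 : ℤ) ^ i • x (i + 1)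

/-- The sum `x_2 + x_4 + ⋯`. -/
def evenSum (x : ℕ → R) (n : ℕ) : R := ∑ i ∈ Finset.range n, if Odd i then x (i + 1) else 0

/-- The sum `x_{n-1} + x_{n-3} + ⋯`. -/
def coevenSum (x : ℕ → R) (n : ℕ) : R :=
  ∑ i ∈ Finset.range n, if Even (n + i) then x (i + 1) else 0

/-- An odd `a` flips the parity of positions in the second block, and `x_1 + x_3 + ⋯` is `x_2 + x_4
+ ⋯` plus the alternating sum. -/
theorem evenSum_add (x : ℕ → R) (a b : ℕ) :
    evenSum x (a + b) = evenSum x a + evenSum (fun i => x (a + i)) b +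
      brace a • altSum (fun i => x (a + i)) b := by
  rw [evenSum, Finset.sum_range_add, add_assoc, evenSum, evenSum, altSum, Finset.smul_sum,
    ← Finset.sum_add_distrib]
  congr 1
  refine Finset.sum_congr rfl fun i _ => ?_
  rw [add_assoc]
  rcases Nat.even_or_odd a with ha | ha <;> rcases Nat.even_or_odd i with hi | hi <;>
    have hi' := hi.neg_one_pow (α := ℤ) <;>
    (try simp only [← Nat.not_even_iff_odd] at ha hi) <;>
    simp [brace, ha, hi, hi', Nat.even_add, ← Nat.not_even_iff_odd]

/-- Here positions are counted from the right end, so the parity of `b` matters and the first block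
changes. The sign is that of `x a` in `altSum x a`. -/
theorem coevenSum_add (x : ℕ → R) (a b : ℕ) :
    coevenSum x (a + b) = coevenSum x a + coevenSum (fun i => x (a + i)) b +
      ((-1) ^ (a + 1) * brace b) • altSum x a := by
  rw [coevenSum, Finset.sum_range_add, add_right_comm, coevenSum, coevenSum, altSum,
    Finset.smul_sum, ← Finset.sum_add_distrib]
  congr 1
  · refine Finset.sum_congr rfl fun i _ => ?_
    rcases Nat.even_or_odd a with ha | ha <;> rcases Nat.even_or_odd i with hi | hi <;>
      rcases Nat.even_or_odd b with hb | hb <;>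
      have hi' := hi.neg_one_pow (α := ℤ) <;> have ha' := ha.neg_one_pow (α := ℤ) <;>
      (try simp only [← Nat.not_even_iff_odd] at ha hi hb) <;>
      simp [brace, ha, hi, hb, hi', ha', Nat.even_add, pow_succ]
  · refine Finset.sum_congr rfl fun i _ => ?_
    rw [show a + b + (a + i) = 2 * a + (b + i) by ring, add_assoc]
    simp [Nat.even_add]

theorem altSum_succ (x : ℕ → R) (n : ℕ) :
    altSum x (n + 1) = altSum x n + (-1 : ℤ) ^ n • x (n + 1) := by
  rw [altSum, Finset.sum_range_succ, ← altSum]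

theorem altSum_succ' (x : ℕ → R) (n : ℕ) :
    altSum x (n + 1) = x 1 - altSum (fun i => x (i + 1)) n := by
  rw [altSum, Finset.sum_range_succ', altSum, add_comm, sub_eq_add_neg, ← Finset.sum_neg_distrib]
  simp [pow_succ]

theorem evenSum_succ (x : ℕ → R) (n : ℕ) :
    evenSum x (n + 1) = evenSum x n + if Odd n then x (n + 1) else 0 := by
  rw [evenSum, Finset.sum_range_succ, ← evenSum]

theorem coevenSum_succ (x : ℕ → R) (n : ℕ) :
    coevenSum x (n + 1) = coevenSum (fun i => x (i + 1)) n + if Odd n then x 1 else 0 := by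
  rw [coevenSum, Finset.sum_range_succ', coevenSum]
  congr 1
  · refine Finset.sum_congr rfl fun i _ => ?_
    rw [show n + 1 + (i + 1) = n + i + 2 by ring]
    simp [Nat.even_add]
  · simp [Nat.even_add_one]

/-- The twisted elementary polynomial slides through the longest word. -/
theorem altSum_mul_longestWord (h : IsONH n x y) :
    altSum x n * longestWord y n =
      (-1 : ℤ) ^ (n.choose 2 + n + 1) • (longestWord y n * altSum x n) := by
  induction n with
  | zero => simp [altSum]
  | succ n ih =>
    rcases n with _ | m
    · simp [longestWord_succ]
    have hu : ∀ i, 1 ≤ i → i < m + 1 → longestWord y (m + 1) * y i = 0 := fun i h1 h2 =>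
      longestWord_mul_cross (h.mono (by omega)) h1 h2
    have e1 : x (m + 1 + 1) * longestWord y (m + 1) =
        (-1 : ℤ) ^ (m + 1).choose 2 • (longestWord y (m + 1) * x (m + 1 + 1)) := by
      rw [longestWord_mul_of_intertwine (ε := -1) (y := y) fun i h1 h2 => by
        rw [h.yx i _ h1 (by omega) (by omega) (by omega) (by omega) (by omega)]; simp]
      rw [smul_smul, ← mul_pow]; simp
    have e2 := mul_dot_last_mul_chain h hu
    have e3 := mul_dot_one_mul_chain (longestWord y (m + 1)) h
    -- The chain rotates the dots cyclically: those on the first `m + 1` strands move one to the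
    -- right, and the last moves to strand 1. Only the first and the last dot leave a correction,
    -- and these two cancel.
    have e4 : longestWord y (m + 1) * altSum x (m + 1) * chain y (m + 1) =
        (-1 : ℤ) ^ (m + 1) • (longestWord y (m + 1 + 1) * altSum (fun i => x (i + 1)) (m + 1)) +
        (-1 : ℤ) ^ m • (longestWord y (m + 1) * chain (fun i => y (1 + i)) m) := by
      rw [altSum, altSum, Finset.sum_range_succ', Finset.sum_range_succ' _ m, mul_add, add_mul,
        mul_add, Finset.mul_sum, Finset.mul_sum, Finset.sum_mul, smul_add, add_assoc]
      simp only [pow_zero, one_smul, zero_add, e3, longestWord_succ y (m + 1), Finset.smul_sum]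
      congr 1
      refine Finset.sum_congr rfl fun i hi => ?_
      rw [mul_smul_comm, smul_mul_assoc, mul_dot_mul_chain (h.mono (by omega)) hu (by omega)
        (by have := Finset.mem_range.1 hi; omega), mul_smul_comm, smul_comm]
    conv_lhs => rw [altSum_succ, add_mul, longestWord_succ y (m + 1), ← mul_assoc,
      ih (h.mono (by omega)), smul_mul_assoc, e4, smul_mul_assoc, ← mul_assoc (x _), e1,
      smul_mul_assoc, e2, ← longestWord_succ]
    rw [altSum_succ' x (m + 1), choose_two_succ (m + 1)]
    simp only [pow_add, smul_add, smul_smul, mul_sub, smul_sub]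
    rcases neg_one_pow_eq_or ℤ m with hm | hm <;>
      rcases neg_one_pow_eq_or ℤ ((m + 1).choose 2) with hc | hc <;>
      simp [hm, hc] <;> abel

/-- The twisted elementary polynomial preserves what is killed by all crossings. -/
theorem cross_mul_altSum_mul {i : ℕ} {u : R} (h : IsONH n x y)
    (hu : ∀ i, 1 ≤ i → i < n → y i * u = 0) (hi : 1 ≤ i) (hin : i < n) :
    y i * (altSum x n * u) = 0 := by
  -- Both `y i * x i` and `y i * x (i + 1)` fix `u`, and the two dots carry opposite signs. A
  -- partial sum survives only if it stops between them.
  have key : ∀ m, m ≤ n → y i * (altSum x m * u) = if m = i then (-1 : ℤ) ^ (i + 1) • u else 0 := by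
    intro m hm
    induction m with
    | zero => rw [if_neg (by omega)]; simp [altSum]
    | succ m ih =>
      rw [altSum_succ, add_mul, mul_add, ih (by omega), smul_mul_assoc, mul_smul_comm, ← mul_assoc]
      rcases eq_or_ne (m + 1) i with rfl | h1
      · rw [h.right _ hi hin, sub_mul, mul_assoc, hu _ hi hin]
        simp [pow_succ]
      · rcases eq_or_ne m i with rfl | h2
        · rw [h.left' hi hin, sub_mul, mul_assoc, hu _ hi hin]
          simp [pow_succ]
        · rw [h.yx i (m + 1) hi hin (by omega) hm h1 (by omega), neg_mul, mul_assoc, hu _ hi hin,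
            if_neg h1, if_neg h2]
          simp
  rw [key n le_rfl, if_neg (by omega)]

end Thick

/-! ### The differential of the longest word, the staircase and the idempotent -/

section Differential

variable (k : Type*) [CommRing k] (n : ℕ)

theorem isONH : IsONH n (X k n) (D k n) where
  xx _ _ _ _ _ _ h := eq_neg_of_add_eq_zero_left (X_mul_X h)
  yy _ _ _ _ _ _ h := eq_neg_of_add_eq_zero_left (D_mul_D h)
  sq i _ _ := D_sq i
  braid i _ _ := D_braid i
  yx _ _ _ _ _ _ h h' := eq_neg_of_add_eq_zero_left (D_mul_X h h')
  left _ h1 h2 := eq_sub_of_add_eq (slide_left ⟨h1, h2⟩)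
  right _ h1 h2 := eq_sub_of_add_eq (slide_right ⟨h1, h2⟩)

variable {k n}

theorem d_one : d k n 1 = 0 := by simpa using d_algebraMap (k := k) (n := n) 1

theorem d_zsmul (z : ℤ) (u : ONH k n) : d k n (z • u) = z • d k n u := map_zsmul _ _ _

theorem parity_zsmul (z : ℤ) (u : ONH k n) : parity k n (z • u) = z • parity k n u :=
  map_zsmul _ _ _

theorem parity_chain (m : ℕ) : parity k n (chain (D k n) m) = (-1 : ℤ) ^ m • chain (D k n) m := by
  induction m with
  | zero => simp
  | succ m ih => rw [chain_succ, map_mul, ih, parity_D, pow_succ, mul_smul_comm]; simp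

theorem parity_longestWord (m : ℕ) :
    parity k n (longestWord (D k n) m) = (-1 : ℤ) ^ m.choose 2 • longestWord (D k n) m := by
  induction m with
  | zero => simp
  | succ m ih =>
    rw [longestWord_succ, map_mul, ih, parity_chain, choose_two_succ, pow_add, smul_mul_smul_comm]

theorem parity_X_pow (i m : ℕ) : parity k n (X k n i ^ m) = (-1 : ℤ) ^ m • X k n i ^ m := by
  rw [map_pow, parity_X, neg_pow]
  rcases Nat.even_or_odd m with h | h <;> simp [h.neg_one_pow]

theorem d_X_pow (i m : ℕ) : d k n (X k n i ^ m) = if Odd m then X k n i ^ (m + 1) else 0 := by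
  induction m with
  | zero => simp [d_one]
  | succ m ih =>
    rw [pow_succ, d_mul, ih, d_X, parity_X_pow]
    rcases Nat.even_or_odd m with h | h
    · rw [if_neg (by simpa using h), if_pos (by simpa using h.add_one), h.neg_one_pow, pow_succ,
        pow_succ]
      simp [mul_assoc]
    · rw [if_pos h, if_neg (by simpa using h.add_one), h.neg_one_pow, pow_succ]
      simp [mul_assoc]

theorem parity_stairWord (s m : ℕ) :
    parity k n (stairWord (fun i => X k n (s + i)) m) =
      (-1 : ℤ) ^ m.choose 2 • stairWord (fun i => X k n (s + i)) m := by
  induction m generalizing s with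
  | zero => simp
  | succ m ih =>
    have := ih (s + 1)
    simp only [add_assoc] at this
    rw [stairWord_succ, map_mul, parity_X_pow, this, smul_mul_smul_comm, choose_two_succ, pow_add,
      mul_comm]

theorem X_pow_mul_coevenSum {s i : ℕ} (hi : i ≤ s) (m l : ℕ) :
    X k n i ^ l * coevenSum (fun i => X k n (s + i)) m =
      (-1 : ℤ) ^ l • (coevenSum (fun i => X k n (s + i)) m * X k n i ^ l) := by
  refine pow_mul_of_intertwine ?_ l
  rw [coevenSum, Finset.mul_sum, Finset.sum_mul, Finset.smul_sum]
  refine Finset.sum_congr rfl fun j _ => ?_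
  split_ifs
  · simp [eq_neg_of_add_eq_zero_left (X_mul_X (k := k) (n := n) (show i ≠ s + (j + 1) by omega))]
  · simp

/-- Odd powers `x ^ m` have differential `x * x ^ m`, and even powers have none. The sign from the
Leibniz rule cancels the one from moving the new dot back to the left. The offset `s` is general
because the recursion of the staircase shifts the strands. -/
theorem d_stairWord (s m : ℕ) :
    d k n (stairWord (fun i => X k n (s + i)) m) =
      coevenSum (fun i => X k n (s + i)) m * stairWord (fun i => X k n (s + i)) m := by
  induction m generalizing s with
  | zero => simp [d_one, coevenSum]
  | succ m ih =>
    have e := X_pow_mul_coevenSum (k := k) (n := n) (le_refl (s + 1)) m m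
    have := ih (s + 1)
    simp only [add_assoc] at this e
    have hf : (fun i => X k n (s + (i + 1))) = fun i => X k n (s + (1 + i)) :=
      funext fun i => by rw [add_comm i]
    rw [stairWord_succ, d_mul, this, parity_X_pow, d_X_pow, coevenSum_succ, hf, add_mul,
      smul_mul_assoc, ← mul_assoc, e, smul_mul_assoc, smul_smul, ← mul_pow, add_comm]
    simp only [mul_neg, mul_one, neg_neg, one_pow, one_smul, ite_mul, zero_mul, ← mul_assoc,
      ← pow_succ']

/-- The differential deletes letters one at a time. Deleting anything but the last letter `∂_1` lets
the next letter move left to `u`, which kills it. -/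
theorem mul_d_chain {m : ℕ} {u : ONH k n} (hm : m + 1 < n)
    (hu : ∀ i, 1 ≤ i → i < m + 1 → u * D k n i = 0) :
    u * d k n (chain (D k n) (m + 1)) =
      (-1 : ℤ) ^ m • (u * chain (fun i => D k n (1 + i)) m) := by
  induction m generalizing u with
  | zero => simp [chain_succ, d_D (k := k) (n := n) (i := 1) ⟨le_rfl, hm⟩]
  | succ m ih =>
    have hu' : ∀ i, 1 ≤ i → i < m + 1 → u * D k n (m + 1 + 1) * D k n i = 0 := fun i h1 h2 => by
      rw [mul_assoc, eq_neg_of_add_eq_zero_left (D_mul_D (k := k) (n := n) (i := m + 1 + 1)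
        (j := i) (by omega)), mul_neg, ← mul_assoc, hu i h1 (by omega), zero_mul, neg_zero]
    have e0 : u * chain (D k n) (m + 1) = 0 := by
      rw [chain_succ, ← mul_assoc, hu _ (by omega) (by omega), zero_mul]
    rw [chain_succ (D k n) (m + 1), d_mul, d_D ⟨by omega, hm⟩, one_mul, mul_add, e0, parity_D,
      neg_mul, mul_neg, ← mul_assoc, ih (by omega) hu', chain_succ _ m, add_comm 1 (m + 1),
      pow_succ]
    simp [mul_assoc]

theorem longestWord_mul_coevenSum_mul_chain {m : ℕ} (hm : m + 2 ≤ n) :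
    longestWord (D k n) (m + 1) * coevenSum (X k n) (m + 1) * chain (D k n) (m + 1) =
      (-1 : ℤ) ^ (m + 1) •
        (longestWord (D k n) (m + 2) * coevenSum (fun i => X k n (i + 1)) (m + 1)) +
      if Even (m + 1) then
        (-1 : ℤ) ^ m • (longestWord (D k n) (m + 1) * chain (fun i => D k n (1 + i)) m) else 0 := by
  have h := (isONH k n).mono hm
  have hu : ∀ i, 1 ≤ i → i < m + 1 → longestWord (D k n) (m + 1) * D k n i = 0 :=
    fun i h1 h2 => longestWord_mul_cross (h.mono (by omega)) h1 h2
  have e := mul_dot_one_mul_chain (longestWord (D k n) (m + 1)) h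
  rw [coevenSum, coevenSum, Finset.sum_range_succ', Finset.sum_range_succ' _ m, mul_add, add_mul,
    mul_add, Finset.mul_sum, Finset.mul_sum, Finset.sum_mul, smul_add, add_assoc (_ • _),
    Finset.smul_sum]
  congr 1
  · refine Finset.sum_congr rfl fun i hi => ?_
    split_ifs
    · rw [mul_dot_mul_chain (h.mono (by omega)) hu (by omega)
        (by have := Finset.mem_range.1 hi; omega), longestWord_succ _ (m + 1)]
    · simp
  · simp only [add_zero, zero_add]
    split_ifs
    · rw [e, longestWord_succ _ (m + 1)]
    · simp

theorem X_mul_longestWord {m : ℕ} (hm : m < n) :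
    X k n (m + 1) * longestWord (D k n) m =
      (-1 : ℤ) ^ m.choose 2 • (longestWord (D k n) m * X k n (m + 1)) := by
  rw [longestWord_mul_of_intertwine (ε := -1) (y := D k n) fun i h1 h2 => by
    rw [(isONH k n).yx i _ h1 (by omega) (by omega) (by omega) (by omega) (by omega)]; simp]
  rw [smul_smul, ← mul_pow]; simp

/-- The differential of the longest word. -/
theorem d_longestWord {m : ℕ} (hm : m ≤ n) :
    d k n (longestWord (D k n) m) = evenSum (X k n) m * longestWord (D k n) m -
      (-1 : ℤ) ^ m.choose 2 • (longestWord (D k n) m * coevenSum (X k n) m) := by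
  induction m with
  | zero => simp [d_one, evenSum, coevenSum]
  | succ m ih =>
    rcases m with _ | m
    · simp [longestWord_succ, d_one, evenSum, coevenSum]
    have h := (isONH k n).mono hm
    have hu : ∀ i, 1 ≤ i → i < m + 1 → longestWord (D k n) (m + 1) * D k n i = 0 :=
      fun i h1 h2 => longestWord_mul_cross (h.mono (by omega)) h1 h2
    have e1 := mul_d_chain hm hu
    have e2 := longestWord_mul_coevenSum_mul_chain (k := k) hm
    have e3 := mul_dot_last_mul_chain h hu
    have e4 := X_mul_longestWord (k := k) (n := n) hm
    conv_lhs => rw [longestWord_succ, d_mul, ih (by omega), sub_mul, smul_mul_assoc, e2,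
      parity_longestWord, smul_mul_assoc, e1, mul_assoc, ← longestWord_succ]
    rw [evenSum_succ _ (m + 1), coevenSum_succ _ (m + 1), add_mul, mul_add]
    -- For even `m + 1`, the term from `d` of the chain cancels the correction from the first dot of
    -- `coevenSum`. For odd `m + 1`, it is the correction arising when the new dot `x_{m+2}` of
    -- `evenSum` crosses the word and becomes the new dot `x_1` of `coevenSum`.
    rcases Nat.even_or_odd (m + 1) with hp | hp
    · have hm' : (-1 : ℤ) ^ m = -1 := by
        rw [Nat.even_add_one, Nat.not_even_iff_odd] at hp; exact hp.neg_one_pow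
      rw [if_pos hp, if_neg (Nat.not_odd_iff_even.2 hp), if_neg (Nat.not_odd_iff_even.2 hp),
        choose_two_succ (m + 1)]
      simp only [pow_add, pow_one, hm']
      simp
      abel
    · have hm' : (-1 : ℤ) ^ m = 1 := by
        rw [Nat.odd_add_one, Nat.not_odd_iff_even] at hp; exact hp.neg_one_pow
      rw [if_neg (Nat.not_even_iff_odd.2 hp), if_pos hp, if_pos hp,
        longestWord_succ _ (m + 1), ← mul_assoc (X k n _), e4, smul_mul_assoc, e3,
        choose_two_succ (m + 1)]
      simp only [pow_add, pow_one, hm', smul_add, mul_one, mul_neg, neg_smul, one_smul, add_zero, smul_neg]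
      abel

/-- The differential of a thick strand. -/
theorem d_thickWord :
    d k n (thickWord (X k n) (D k n) n) = evenSum (X k n) n * thickWord (X k n) (D k n) n := by
  have e := d_stairWord (k := k) (n := n) 0 n
  simp only [zero_add] at e
  rw [thickWord, d_zsmul, d_mul, d_longestWord le_rfl, e, parity_longestWord, mul_smul_comm,
    sub_mul, smul_mul_assoc, smul_mul_assoc, mul_assoc, ← mul_assoc (longestWord _ _) (coevenSum _ _),
    sub_add_cancel]

theorem parity_thickWord :
    parity k n (thickWord (X k n) (D k n) n) = thickWord (X k n) (D k n) n := by
  have e := parity_stairWord (k := k) (n := n) 0 n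
  simp only [zero_add] at e
  rw [thickWord, parity_zsmul, map_mul, parity_longestWord, e, smul_mul_smul_comm, ← mul_pow]
  simp

/-- For an even idempotent, `d e = d e * e + e * d e`. Since `d e = P e`, the first summand is
already `d e`, so the second vanishes. -/
theorem thickWord_mul_evenSum_mul_thickWord :
    thickWord (X k n) (D k n) n * evenSum (X k n) n * thickWord (X k n) (D k n) n = 0 := by
  have e := d_mul (thickWord (X k n) (D k n) n) (thickWord (X k n) (D k n) n)
  rw [thickWord_mul_thickWord (isONH k n), d_thickWord, parity_thickWord, mul_assoc,
    thickWord_mul_thickWord (isONH k n), ← mul_assoc] at e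
  exact left_eq_add.1 e

end Differential

/-! ### Juxtaposed thick strands and the splitter -/

theorem map_longestWord {R S F : Type*} [Ring R] [Ring S] [FunLike F R S] [RingHomClass F R S]
    (f : F) {y : ℕ → R} {y' : ℕ → S} {n : ℕ} (h : ∀ i, 1 ≤ i → i < n → f (y i) = y' i) :
    f (longestWord y n) = longestWord y' n := by
  have hc : ∀ m, m < n → f (chain y m) = chain y' m := by
    intro m hm
    induction m with
    | zero => simp
    | succ m ih => rw [chain_succ, chain_succ, map_mul, ih (by omega), h _ (by omega) hm]
  induction n with
  | zero => simp
  | succ n ih =>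
    rw [longestWord_succ, longestWord_succ, map_mul, hc n (by omega),
      ih (fun i h1 h2 => h i h1 (by omega)) fun m hm => hc m (by omega)]

theorem map_stairWord {R S F : Type*} [Ring R] [Ring S] [FunLike F R S] [RingHomClass F R S]
    (f : F) {x : ℕ → R} {x' : ℕ → S} {n : ℕ} (h : ∀ i, 1 ≤ i → i ≤ n → f (x i) = x' i) :
    f (stairWord x n) = stairWord x' n := by
  rw [stairWord, stairWord, map_list_prod, List.map_map]
  congr 1
  refine List.map_congr_left fun j hj => ?_
  have := List.mem_range.1 hj
  simp [h (j + 1) (by omega) (by omega)]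

theorem map_thickWord {R S F : Type*} [Ring R] [Ring S] [FunLike F R S] [RingHomClass F R S]
    (f : F) {x y : ℕ → R} {x' y' : ℕ → S} {n : ℕ} (hx : ∀ i, 1 ≤ i → i ≤ n → f (x i) = x' i)
    (hy : ∀ i, 1 ≤ i → i < n → f (y i) = y' i) :
    f (thickWord x y n) = thickWord x' y' n := by
  rw [thickWord, thickWord, map_zsmul, map_mul, map_longestWord f hy, map_stairWord f hx]

theorem map_evenSum {R S F : Type*} [Ring R] [Ring S] [FunLike F R S] [RingHomClass F R S]
    (f : F) {x : ℕ → R} {x' : ℕ → S} {n : ℕ} (h : ∀ i, 1 ≤ i → i ≤ n → f (x i) = x' i) :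
    f (evenSum x n) = evenSum x' n := by
  rw [evenSum, evenSum, map_sum]
  refine Finset.sum_congr rfl fun i hi => ?_
  have := Finset.mem_range.1 hi
  split_ifs
  · exact h _ (by omega) (by omega)
  · exact map_zero f

theorem map_altSum {R S F : Type*} [Ring R] [Ring S] [FunLike F R S] [RingHomClass F R S]
    (f : F) {x : ℕ → R} {x' : ℕ → S} {n : ℕ} (h : ∀ i, 1 ≤ i → i ≤ n → f (x i) = x' i) :
    f (altSum x n) = altSum x' n := by
  rw [altSum, altSum, map_sum]
  refine Finset.sum_congr rfl fun i hi => ?_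
  have := Finset.mem_range.1 hi
  rw [map_zsmul, h _ (by omega) (by omega)]

section

variable (k : Type*) [CommRing k]

theorem thick_eq (n : ℕ) : thick k n = thickWord (X k n) (D k n) n := by
  rw [thick, thickWord, zsmul_eq_mul, ← mul_assoc]
  push_cast
  rfl

theorem twistedE1_eq (n : ℕ) : twistedE1 k n = altSum (X k n) n := by
  rw [twistedE1, altSum, Finset.range_eq_Ico, ← Finset.Ico_add_one_right_eq_Icc,
    ← zero_add 1, ← Finset.sum_Ico_add']
  refine Finset.sum_congr (by simp) fun i _ => ?_
  rw [zsmul_eq_mul]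
  push_cast
  simp

theorem bunchCross_eq (a b : ℕ) :
    bunchCross k a b =
      ((List.range a).map fun j => chain (fun i => D k (a + b) (j + i)) b).prod := by
  rw [bunchCross]
  congr 1
  refine List.map_congr_left fun j _ => ?_
  rw [chain]
  congr 1
  refine List.map_congr_left fun l hl => ?_
  have := List.mem_range.1 hl
  rw [show b + j - l = j + (b - l) by omega]

variable {k} {a b : ℕ}

theorem addRight_X {i : ℕ} (h1 : 1 ≤ i) (h2 : i ≤ a) : addRight k a b (X k a i) = X k (a + b) i :=
  lift_X _ _ _ _ _ _ _ _ _ ⟨h1, h2⟩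

theorem addRight_D {i : ℕ} (h1 : 1 ≤ i) (h2 : i < a) : addRight k a b (D k a i) = D k (a + b) i :=
  lift_D _ _ _ _ _ _ _ _ _ ⟨h1, h2⟩

theorem addLeft_X {i : ℕ} (h1 : 1 ≤ i) (h2 : i ≤ b) :
    addLeft k a b (X k b i) = X k (a + b) (a + i) :=
  lift_X _ _ _ _ _ _ _ _ _ ⟨h1, h2⟩

theorem addLeft_D {i : ℕ} (h1 : 1 ≤ i) (h2 : i < b) :
    addLeft k a b (D k b i) = D k (a + b) (a + i) :=
  lift_D _ _ _ _ _ _ _ _ _ ⟨h1, h2⟩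

variable (k a b)

theorem addRight_thick :
    addRight k a b (thick k a) = thickWord (X k (a + b)) (D k (a + b)) a := by
  rw [thick_eq]
  exact map_thickWord _ (fun i => addRight_X) fun i => addRight_D

theorem addLeft_thick :
    addLeft k a b (thick k b) =
      thickWord (fun i => X k (a + b) (a + i)) (fun i => D k (a + b) (a + i)) b := by
  rw [thick_eq]
  exact map_thickWord _ (fun i => addLeft_X) fun i => addLeft_D

theorem addRight_thick_mul_evenSum_mul :
    addRight k a b (thick k a) * evenSum (X k (a + b)) a * addRight k a b (thick k a) = 0 := by
  rw [← map_evenSum (addRight k a b) (fun i => addRight_X), ← map_mul, ← map_mul, thick_eq,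
    thickWord_mul_evenSum_mul_thickWord, map_zero]

theorem addLeft_thick_mul_evenSum_mul :
    addLeft k a b (thick k b) * evenSum (fun i => X k (a + b) (a + i)) b *
      addLeft k a b (thick k b) = 0 := by
  rw [← map_evenSum (addLeft k a b) (fun i => addLeft_X), ← map_mul, ← map_mul, thick_eq,
    thickWord_mul_evenSum_mul_thickWord, map_zero]

variable {k a b}

theorem thick_mul_thick (n : ℕ) : thick k n * thick k n = thick k n := by
  rw [thick_eq, thickWord_mul_thickWord (isONH k n)]

/-- A thick strand is even, so it commutes with everything far away. -/
theorem commute_addLeft_thick (u : ONH k a) :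
    Commute (addLeft k a b (thick k b)) (addRight k a b u) := by
  have key : ∀ z : ONH k (a + b),
      (∀ i, 1 ≤ i → i ≤ b → X k (a + b) (a + i) * z = (-1 : ℤ) • (z * X k (a + b) (a + i))) →
      (∀ i, 1 ≤ i → i < b → D k (a + b) (a + i) * z = (-1 : ℤ) • (z * D k (a + b) (a + i))) →
      Commute (addLeft k a b (thick k b)) z := by
    intro z hx hy
    rw [addLeft_thick, thickWord]
    refine Commute.smul_left ?_ _
    rw [Commute, SemiconjBy, mul_assoc, stairWord_mul_of_intertwine hx, mul_smul_comm, ← mul_assoc,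
      longestWord_mul_of_intertwine hy, smul_mul_assoc, smul_smul, ← mul_pow, mul_assoc]
    simp
  induction u using induction with
  | scalar c => simpa using Algebra.commute_algebraMap_right c _
  | dot i h =>
    rw [addRight_X h.1 h.2]
    refine key _ (fun j h1 h2 => ?_) fun j h1 h2 => ?_
    · rw [eq_neg_of_add_eq_zero_left (X_mul_X (by omega))]; simp
    · rw [eq_neg_of_add_eq_zero_left (D_mul_X (by omega) (by omega))]; simp
  | cross i h =>
    rw [addRight_D h.1 h.2]
    refine key _ (fun j h1 h2 => ?_) fun j h1 h2 => ?_
    · rw [eq_neg_of_add_eq_zero_right (D_mul_X (by omega) (by omega))]; simp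
    · rw [eq_neg_of_add_eq_zero_left (D_mul_D (by omega))]; simp
  | mul u v hu hv => rw [map_mul]; exact hu.mul_right hv
  | add u v hu hv => rw [map_add]; exact hu.add_right hv

theorem cross_mul_thick {n i : ℕ} (h1 : 1 ≤ i) (h2 : i < n) : D k n i * thick k n = 0 := by
  rw [thick_eq]; exact cross_mul_thickWord (isONH k n) h1 h2

theorem addRight_thick_mul_thick :
    addRight k a b (thick k a) * thick k (a + b) = thick k (a + b) := by
  rw [addRight_thick]
  exact thickWord_mul ((isONH k _).mono (by omega)) fun i h1 h2 => cross_mul_thick h1 (by omega)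

theorem addLeft_thick_mul_thick :
    addLeft k a b (thick k b) * thick k (a + b) = thick k (a + b) := by
  rw [addLeft_thick]
  exact thickWord_mul ((isONH k _).shift le_rfl) fun i h1 h2 =>
    cross_mul_thick (by omega) (by omega)

/-- All crossings kill `e_{a+b}` from the left, in particular those inside each block, so both
smaller idempotents fix it. -/
theorem splitter_eq : splitter k a b = thick k (a + b) := by
  rw [splitter, thickPair, juxt, mul_assoc, addLeft_thick_mul_thick, addRight_thick_mul_thick]

theorem thickDiff_splitter :
    thickDiff (thickPair k a b) (splitter k a b) =
      brace a • (juxt (thick k a) (label k (twistedE1 k b)) * splitter k a b) := by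
  have hA := addRight_thick_mul_evenSum_mul k a b
  have hB := addLeft_thick_mul_evenSum_mul k a b
  have hE : addLeft k a b (twistedE1 k b) = altSum (fun i => X k (a + b) (a + i)) b := by
    rw [twistedE1_eq]; exact map_altSum _ fun i => addLeft_X
  have hP : addRight k a b (evenSum (X k a) a) = evenSum (X k (a + b)) a :=
    map_evenSum _ fun i => addRight_X
  have hc := commute_addLeft_thick (b := b) (evenSum (X k a) a)
  rw [hP] at hc
  -- The even idempotent of the second block passes the dots of the first and is absorbed. Splitting
  -- `e_a` off `e_{a+b}` then leaves `e_a P_a e_a`, which vanishes.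
  have e1 : juxt (thick k a) (thick k b) * (evenSum (X k (a + b)) a * thick k (a + b)) = 0 := by
    rw [juxt, mul_assoc, ← mul_assoc (addLeft k a b _), hc.eq, mul_assoc, addLeft_thick_mul_thick,
      ← addRight_thick_mul_thick, ← mul_assoc, ← mul_assoc, hA, zero_mul]
  have e2 : juxt (thick k a) (thick k b) *
      (evenSum (fun i => X k (a + b) (a + i)) b * thick k (a + b)) = 0 := by
    rw [juxt, mul_assoc, ← addLeft_thick_mul_thick, ← mul_assoc (evenSum _ _),
      ← mul_assoc (addLeft k a b _), ← mul_assoc (addLeft k a b _), hB, zero_mul, mul_zero]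
  rw [splitter_eq, thickDiff, thickPair]
  conv_lhs => rw [thick_eq k (a + b), d_thickWord, ← thick_eq, evenSum_add, add_mul, add_mul,
    mul_add, mul_add, e1, e2, zero_add, zero_add, smul_mul_assoc, mul_smul_comm]
  rw [label, juxt, juxt, map_mul, map_mul, hE]
  simp only [mul_assoc]
  rw [addLeft_thick_mul_thick]

/-! ### The merge -/

/-- The last row of the bunch crossing and the last chain of the left longest word join to the full
chain `y_{a+b} ⋯ y_1`. Pulling the right longest word through it lowers its indices by one, which
leaves the case of one strand less. Only signs arise, and their product is left as `τ`. -/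
theorem bunchCross_mul_longestWord {R : Type*} [Ring R] {x y : ℕ → R} (a b : ℕ)
    (h : IsONH (a + b) x y) :
    ∃ τ : ℤ, ((List.range a).map fun j => chain (fun i => y (j + i)) b).prod * longestWord y a *
      longestWord (fun i => y (a + i)) b = τ • longestWord y (a + b) := by
  induction a with
  | zero => exact ⟨1, by simp⟩
  | succ a ih =>
    obtain ⟨τ, hτ⟩ := ih (h.mono (by omega))
    have e1 : longestWord y a * chain (fun i => y (a + i)) b =
        ((-1 : ℤ) ^ b) ^ a.choose 2 • (chain (fun i => y (a + i)) b * longestWord y a) := by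
      refine longestWord_mul_of_intertwine fun i h1 h2 => ?_
      rw [chain_mul_of_intertwine (ε := -1) (y := fun i => y (a + i)) fun j h3 h4 => by
        rw [h.yy _ i (by omega) (by omega) h1 (by omega) (by omega)]; simp]
      rw [smul_smul, ← mul_pow]; simp
    have e1' : chain (fun i => y (a + i)) b * longestWord y a =
        ((-1 : ℤ) ^ b) ^ a.choose 2 • (longestWord y a * chain (fun i => y (a + i)) b) := by
      rw [e1, smul_smul, ← mul_pow, ← mul_pow]; simp
    have e2 : longestWord (fun i => y (a + i)) b * chain y (a + b) =
        ((-1 : ℤ) ^ (a + b)) ^ b.choose 2 •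
          (chain y (a + b) * longestWord (fun i => y (a + 1 + i)) b) := by
      refine longestWord_mul_of_intertwine fun i h1 h2 => ?_
      have := chain_mul_cross (m := a + b) (i := a + i) h (by omega) (by omega) (by omega)
      rw [show a + 1 + i = a + i + 1 by ring, this, smul_smul, ← mul_pow]
      simp
    have e2' : chain y (a + b) * longestWord (fun i => y (a + 1 + i)) b =
        ((-1 : ℤ) ^ (a + b)) ^ b.choose 2 •
          (longestWord (fun i => y (a + i)) b * chain y (a + b)) := by
      rw [e2, smul_smul, ← mul_pow, ← mul_pow]; simp
    refine ⟨((-1 : ℤ) ^ b) ^ a.choose 2 * ((-1 : ℤ) ^ (a + b)) ^ b.choose 2 * τ, ?_⟩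
    rw [add_right_comm a 1 b, longestWord_succ y (a + b), mul_smul, ← smul_mul_assoc, ← hτ,
      List.range_succ, List.map_append, List.prod_append, longestWord_succ y a]
    simp only [List.map_cons, List.map_nil, List.prod_cons, List.prod_nil, mul_one]
    rw [mul_assoc, mul_assoc, mul_assoc (longestWord y a), ← mul_assoc (chain _ b), e1',
      smul_mul_assoc, mul_smul_comm, mul_assoc (longestWord y a), ← mul_assoc (chain _ b),
      ← chain_add, e2', mul_smul_comm, mul_smul_comm, smul_smul]
    simp only [mul_assoc]

end

/-! ### The differential of the merge -/

theorem choose_two_add (a b : ℕ) : (a + b).choose 2 = a.choose 2 + b.choose 2 + a * b := by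
  induction b with
  | zero => simp
  | succ b ih => rw [← add_assoc, choose_two_succ, choose_two_succ, ih]; ring

section

variable {k : Type*} [CommRing k] {a b : ℕ}

/-- Words in odd letters on the last `b` strands pass dots on the first `a` strands. -/
theorem X_mul_longestWord_shift {i : ℕ} (hi : i ≤ a) :
    X k (a + b) i * longestWord (fun i => D k (a + b) (a + i)) b =
      (-1 : ℤ) ^ b.choose 2 • (longestWord (fun i => D k (a + b) (a + i)) b * X k (a + b) i) := by
  rw [longestWord_mul_of_intertwine (ε := -1) (y := fun i => D k (a + b) (a + i)) fun j h1 h2 => by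
    rw [eq_neg_of_add_eq_zero_left (D_mul_X (by omega) (by omega))]; simp]
  rw [smul_smul, ← mul_pow]; simp

theorem stairWord_mul_longestWord_shift :
    stairWord (X k (a + b)) a * longestWord (fun i => D k (a + b) (a + i)) b =
      ((-1 : ℤ) ^ b.choose 2) ^ a.choose 2 •
        (longestWord (fun i => D k (a + b) (a + i)) b * stairWord (X k (a + b)) a) :=
  stairWord_mul_of_intertwine fun _ _ h2 => X_mul_longestWord_shift h2

theorem altSum_mul_longestWord_shift :
    altSum (X k (a + b)) a * longestWord (fun i => D k (a + b) (a + i)) b =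
      (-1 : ℤ) ^ b.choose 2 •
        (longestWord (fun i => D k (a + b) (a + i)) b * altSum (X k (a + b)) a) := by
  rw [altSum, Finset.sum_mul, Finset.mul_sum, Finset.smul_sum]
  refine Finset.sum_congr rfl fun i hi => ?_
  have := Finset.mem_range.1 hi
  rw [smul_mul_assoc, X_mul_longestWord_shift (by omega), mul_smul_comm, smul_comm]

theorem thick_mul_longestWord (n : ℕ) :
    thick k n * longestWord (D k n) n = longestWord (D k n) n := by
  rw [thick_eq, thickWord_mul_longestWord (isONH k n)]

theorem thick_mul_evenSum_mul_longestWord (n : ℕ) :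
    thick k n * (evenSum (X k n) n * longestWord (D k n) n) = 0 := by
  rw [← thick_mul_longestWord, ← mul_assoc, ← mul_assoc, thick_eq,
    thickWord_mul_evenSum_mul_thickWord, zero_mul]

theorem thick_mul_bunchCross_mul_longestWord (a b : ℕ) :
    ∃ τ : ℤ, thick k (a + b) * (bunchCross k a b * longestWord (D k (a + b)) a *
      longestWord (fun i => D k (a + b) (a + i)) b) = τ • longestWord (D k (a + b)) (a + b) := by
  obtain ⟨τ, hτ⟩ := bunchCross_mul_longestWord a b (isONH k (a + b))
  exact ⟨τ, by rw [bunchCross_eq, hτ, mul_smul_comm, thick_mul_longestWord]⟩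

theorem thickPair_eq :
    thickPair k a b =
      ((-1 : ℤ) ^ a.choose 3 * (-1) ^ b.choose 3 * ((-1) ^ b.choose 2) ^ a.choose 2) •
        (longestWord (D k (a + b)) a * longestWord (fun i => D k (a + b) (a + i)) b *
          (stairWord (X k (a + b)) a * stairWord (fun i => X k (a + b) (a + i)) b)) := by
  rw [thickPair, juxt, addRight_thick, addLeft_thick, thickWord, thickWord, smul_mul_smul_comm,
    mul_assoc (longestWord _ a), ← mul_assoc (stairWord _ a), stairWord_mul_longestWord_shift]
  simp only [smul_mul_assoc, mul_smul_comm, smul_smul, mul_assoc]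

/-- The differential of the merge, up to its overall scalar. -/
theorem thick_mul_d_longestWord_mul_stairWord :
    thick k (a + b) * d k (a + b) (longestWord (D k (a + b)) (a + b) *
        (stairWord (X k (a + b)) a * stairWord (fun i => X k (a + b) (a + i)) b)) =
      ((-1 : ℤ) ^ ((a + b).choose 2 + a) * brace b) •
        (longestWord (D k (a + b)) (a + b) * altSum (X k (a + b)) a *
          (stairWord (X k (a + b)) a * stairWord (fun i => X k (a + b) (a + i)) b)) := by
  have hd := d_stairWord (k := k) (n := a + b) 0 a
  have hp := parity_stairWord (k := k) (n := a + b) 0 a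
  simp only [zero_add] at hd hp
  have hc : stairWord (X k (a + b)) a * coevenSum (fun i => X k (a + b) (a + i)) b =
      (-1 : ℤ) ^ a.choose 2 •
        (coevenSum (fun i => X k (a + b) (a + i)) b * stairWord (X k (a + b)) a) :=
    stairWord_mul_of_intertwine fun i _ h2 => by
      simpa using X_pow_mul_coevenSum (k := k) (n := a + b) h2 b 1
  have hs : d k (a + b)
      (stairWord (X k (a + b)) a * stairWord (fun i => X k (a + b) (a + i)) b) =
      (coevenSum (X k (a + b)) a + coevenSum (fun i => X k (a + b) (a + i)) b) *
        (stairWord (X k (a + b)) a * stairWord (fun i => X k (a + b) (a + i)) b) := by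
    rw [d_mul, hd, hp, d_stairWord, smul_mul_assoc, ← mul_assoc (stairWord _ a), hc,
      smul_mul_assoc, smul_smul, ← mul_pow, add_mul]
    simp [mul_assoc]
  rw [d_mul, d_longestWord le_rfl, hs, parity_longestWord, coevenSum_add]
  set S := stairWord (X k (a + b)) a * stairWord (fun i => X k (a + b) (a + i)) b
  have h1 := thick_mul_evenSum_mul_longestWord (k := k) (a + b)
  have h2 := thick_mul_longestWord (k := k) (a + b)
  simp only [mul_add, mul_sub, sub_mul, add_mul, smul_add, mul_smul_comm, smul_mul_assoc,
    ← mul_assoc, h2] at h1 ⊢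
  -- The `coevenSum` terms of the two blocks cancel against the differentials of the staircases. The
  -- excess from `coevenSum_add` remains, with this sign.
  have h3 : (-1 : ℤ) ^ (a + b).choose 2 * ((-1) ^ (a + 1) * brace b) =
      -((-1 : ℤ) ^ ((a + b).choose 2 + a) * brace b) := by
    rw [pow_add, pow_succ]; ring
  rw [h1, zero_mul, smul_smul, h3, neg_smul]
  abel

/-- The alternating sum preserves what all crossings kill, so `e_a` to the left of it is absorbed
and the label becomes a bare sum of dots above the strands. -/
theorem altSum_mul_thickPair :
    thickPair k a b * juxt (label k (twistedE1 k a)) (thick k b) =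
      altSum (X k (a + b)) a * thickPair k a b := by
  have hE : addRight k a b (twistedE1 k a) = altSum (X k (a + b)) a := by
    rw [twistedE1_eq]; exact map_altSum _ fun i => addRight_X
  have hc := commute_addLeft_thick (b := b) (label k (twistedE1 k a))
  have h1 : thick k a * (twistedE1 k a * thick k a) = twistedE1 k a * thick k a := by
    conv_lhs => rw [thick_eq k a, twistedE1_eq]
    rw [thick_eq k a, twistedE1_eq]
    exact thickWord_mul (isONH k a) fun i h1 h2 =>
      cross_mul_altSum_mul (isONH k a) (fun j h3 h4 => cross_mul_thickWord (isONH k a) h3 h4) h1 h2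
  have h2 : thick k a * label k (twistedE1 k a) = twistedE1 k a * thick k a := by
    rw [label, mul_assoc, h1, h1]
  rw [thickPair, juxt, juxt, mul_assoc, ← mul_assoc (addLeft k a b _), hc.eq, mul_assoc,
    ← mul_assoc, ← map_mul, ← map_mul, thick_mul_thick, h2, map_mul, hE, mul_assoc]

theorem altSum_mul_longestWord_mul_longestWord_shift :
    altSum (X k (a + b)) a *
        (longestWord (D k (a + b)) a * longestWord (fun i => D k (a + b) (a + i)) b) =
      (-1 : ℤ) ^ (a.choose 2 + a + 1 + b.choose 2) •
        (longestWord (D k (a + b)) a * longestWord (fun i => D k (a + b) (a + i)) b *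
          altSum (X k (a + b)) a) := by
  rw [← mul_assoc, altSum_mul_longestWord ((isONH k _).mono (by omega)), smul_mul_assoc, mul_assoc,
    altSum_mul_longestWord_shift, mul_smul_comm, smul_smul, ← pow_add, ← mul_assoc]

/-- Both sides become multiples of the longest word times the alternating sum times the two
staircases, with `τ` and `c` as common factors. Only signs are left to compare. -/
theorem thickDiff_merge (ha : 0 < a) (hb : 0 < b) :
    thickDiff (thick k (a + b)) (merge k a b) =
      ((-1) ^ (a * b - 1) * brace b) •
        (merge k a b * juxt (label k (twistedE1 k a)) (thick k b)) := by
  obtain ⟨τ, hτ⟩ := thick_mul_bunchCross_mul_longestWord (k := k) a b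
  rw [thickDiff, merge, mul_assoc (_ * _) (thickPair k a b), altSum_mul_thickPair, thickPair_eq]
  set S := stairWord (X k (a + b)) a * stairWord (fun i => X k (a + b) (a + i)) b with hS
  set c := ((-1 : ℤ) ^ a.choose 3 * (-1) ^ b.choose 3 * ((-1) ^ b.choose 2) ^ a.choose 2)
  have hl : ∀ v : ONH k (a + b), thick k (a + b) * bunchCross k a b *
      (longestWord (D k (a + b)) a * longestWord (fun i => D k (a + b) (a + i)) b * v) =
      τ • (longestWord (D k (a + b)) (a + b) * v) := fun v => by
    rw [← smul_mul_assoc, ← hτ]; simp only [mul_assoc]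
  rw [mul_smul_comm, mul_smul_comm, mul_smul_comm, ← mul_assoc (altSum _ _),
    altSum_mul_longestWord_mul_longestWord_shift, smul_mul_assoc, mul_assoc _ (altSum _ _) S,
    mul_smul_comm, hl, hl, d_zsmul, d_zsmul, mul_smul_comm, mul_smul_comm, hS,
    thick_mul_d_longestWord_mul_stairWord]
  simp only [smul_smul, mul_assoc]
  congr 1
  -- Positivity of `a * b` makes the truncated subtraction in `a * b - 1` genuine. The exponent `a *
  -- b` enters through the binomial coefficient of `a + b`.
  obtain ⟨m, hm⟩ : ∃ m, a * b = m + 1 :=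
    ⟨a * b - 1, by have := Nat.mul_pos ha hb; omega⟩
  rw [choose_two_add, hm, Nat.add_sub_cancel]
  simp only [pow_add, pow_one]
  ring

end

end OddThick

theorem mainTheorem12 (k : Type*) [CommRing k] (a b : ℕ) (ha : 0 < a) (hb : 0 < b) :
    OddThick.thickDiff (OddThick.thickPair k a b) (OddThick.splitter k a b) =
        OddThick.brace a •
          (OddThick.juxt (OddThick.thick k a) (OddThick.label k (OddThick.twistedE1 k b)) *
            OddThick.splitter k a b) ∧
      OddThick.thickDiff (OddThick.thick k (a + b)) (OddThick.merge k a b) =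
        ((-1) ^ (a * b - 1) * OddThick.brace b) •
          (OddThick.merge k a b *
            OddThick.juxt (OddThick.label k (OddThick.twistedE1 k a)) (OddThick.thick k b)) :=
  ⟨OddThick.thickDiff_splitter, OddThick.thickDiff_merge ha hb⟩
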